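/- Let $\Gamma$ be a finite simple graph without isolated vertices, with $n$ vertices and $N$ edges. Orient each edge $e_j$ arbitrarily and identify it with $[0,1]$; for a vertex $v$ put $d_{vj}=1$ if $v$ is the end point of $e_j$ with parameter $1$, $d_{vj}=-1$ if $v$ is the end point with parameter $0$, and $d_{vj}=0$ otherwise. For $u=(u_j)_{j=1}^N\in C^2([0,1];\mathbb C)^N$ and $v\in e_j$ let $u_j(v)$ and $u_j'(v)$ be the values of $u_j$ and of its (one-sided) derivative at the parameter of $v$. Let $\Delta^{CK}$ and $\Delta^{KC}$ be the operators $(u_j)\mapsto(u_j'')$ whose domains consist of all $u\in C^2([0,1];\mathbb C)^N$ such that, for every vertex $v$, - ($CK$) $u_j(v)=u_k(v)$ for all edges $e_j,e_k$ incident with $v$, and $\sum_{j} d_{vj}\,u_j'(v)=0$; - ($KC$) $\sum_j d_{vj}^2\,u_j(v)=0$, and $d_{vj}\,u_j'(v)=d_{vk}\,u_k'(v)$ for all edges $e_j,e_k$ incident with $v$, respectively. The multiplicity of $\lambda$ is the dimension of $\{u : -\Delta u=\lambda u\}$. Two graphs are isospectral for $-\Delta^{CK}$ (respectively $-\Delta^{KC}$)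 if these operators have the same eigenvalues with the same multiplicities. (i) The eigenvalues with multiplicities of either $-\Delta^{CK}$ or $-\Delta^{KC}$ determine the number $n$ of vertices, the number $N$ of edges, the number $c$ of connected components, the numbers $c^+$ and $c^-$ of bipartite and of non-bipartite connected components, and hence whether the graph is bipartite. That is, if two finite simple graphs without isolated vertices are isospectral for $-\Delta^{CK}$ or isospectral for $-\Delta^{KC}$, then they agree in all these invariants. (ii) They do not determine the vertex degrees, whether the graph is regular, or the complexity (the number of spanning trees). Indeed, let $\Gamma_1$ be the circuit of length $8$, and $\Gamma_2$ the circuit of length $4$ with two paths of length $2$ glued, each by one of its end points, to one and the same vertex of the circuit. Then $\Gamma_1$ and $\Gamma_2$ are isospectral both for $-\Delta^{CK}$ and for $-\Delta^{KC}$, but their multisets of vertex degrees differ, $\Gamma_1$ is regular and $\Gamma_2$ is not, and their complexities are $8$ and $4$, respectively. -/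

import Mathlib

/-! Complex-valued functions on `[0,1]` and their (one-sided at the end points) derivatives. -/

namespace QGraph

open Set

noncomputable section

/-- `f : [0,1] → ℂ`, extended constantly outside `[0,1]`; only its values on `[0,1]` matter below. -/
def ext (f : unitInterval → ℂ) : ℝ → ℂ := IccExtend (zero_le_one : (0 : ℝ) ≤ 1) f

/-- First derivative of `f` on `[0,1]` (one-sided at `0` and `1`). -/
def d1 (f : unitInterval → ℂ) (x : unitInterval) : ℂ := derivWithin (ext f) (Icc 0 1) x

/-- Second derivative of `f` on `[0,1]` (one-sided at `0` and `1`). -/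
def d2 (f : unitInterval → ℂ) (x : unitInterval) : ℂ := iteratedDerivWithin 2 (ext f) (Icc 0 1) x

/-- `f ∈ C²[0,1]`. -/
def IsC2 (f : unitInterval → ℂ) : Prop := ContDiffOn ℝ 2 (ext f) (Icc 0 1)

theorem ext_add (f g : unitInterval → ℂ) : ext (f + g) = ext f + ext g := rfl

theorem ext_smul (a : ℂ) (f : unitInterval → ℂ) : ext (a • f) = a • ext f := rfl

theorem IsC2.zero : IsC2 0 := by
  have h : ext 0 = fun _ => 0 := rfl
  rw [IsC2, h]
  exact contDiffOn_const

theorem IsC2.add {f g : unitInterval → ℂ} (hf : IsC2 f) (hg : IsC2 g) : IsC2 (f + g) := by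
  rw [IsC2, ext_add]
  exact ContDiffOn.add hf hg

theorem IsC2.smul (a : ℂ) {f : unitInterval → ℂ} (hf : IsC2 f) : IsC2 (a • f) := by
  rw [IsC2, ext_smul]
  exact ContDiffOn.const_smul a hf

theorem d1_zero (x : unitInterval) : d1 0 x = 0 := by
  have h : ext 0 = fun _ => 0 := rfl
  rw [d1, h]
  simp

theorem d1_add {f g : unitInterval → ℂ} (hf : IsC2 f) (hg : IsC2 g) (x : unitInterval) :
    d1 (f + g) x = d1 f x + d1 g x := by
  rw [d1, ext_add]
  exact derivWithin_add (hf.differentiableOn (by norm_num) x x.2)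
    (hg.differentiableOn (by norm_num) x x.2)

theorem d1_smul (a : ℂ) {f : unitInterval → ℂ} (hf : IsC2 f) (x : unitInterval) :
    d1 (a • f) x = a * d1 f x := by
  rw [d1, ext_smul]
  exact derivWithin_const_smul a (hf.differentiableOn (by norm_num) x x.2)

theorem d2_add {f g : unitInterval → ℂ} (hf : IsC2 f) (hg : IsC2 g) (x : unitInterval) :
    d2 (f + g) x = d2 f x + d2 g x := by
  rw [d2, ext_add]
  exact iteratedDerivWithin_add x.2 (uniqueDiffOn_Icc zero_lt_one) (hf x x.2) (hg x x.2)

theorem d2_smul (a : ℂ) {f : unitInterval → ℂ} (hf : IsC2 f) (x : unitInterval) :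
    d2 (a • f) x = a * d2 f x := by
  rw [d2, ext_smul]
  exact iteratedDerivWithin_const_smul x.2 (uniqueDiffOn_Icc zero_lt_one) a (hf x x.2)

/-! Orientations, and the Laplacians on the associated network with edges of length `1`. -/

/-- An orientation of a simple graph: a parametrization of each edge by `[0,1]` is determined by
its end point `src e` (parameter `0`) and its end point `tgt e` (parameter `1`). -/
structure Orientation {V : Type*} (G : SimpleGraph V) where
  src : G.edgeSet → V
  tgt : G.edgeSet → V
  mk_eq : ∀ e, s(src e, tgt e) = (e : Sym2 V)

instance {V : Type*} (G : SimpleGraph V) : Nonempty (Orientation G) :=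
  ⟨{ src := fun e => (Quot.out (e : Sym2 V)).1
     tgt := fun e => (Quot.out (e : Sym2 V)).2
     mk_eq := fun e => Quot.out_eq (e : Sym2 V) }⟩

variable {V : Type*} [Fintype V] [DecidableEq V] {G : SimpleGraph V} [DecidableRel G.Adj]

/-- Entry of the signed incidence matrix: `1` at the end, `-1` at the origin of the edge. -/
def Orientation.inc (O : Orientation G) (v : V) (e : G.edgeSet) : ℂ :=
  if O.tgt e = v then 1 else if O.src e = v then -1 else 0

/-- The parameter in `[0,1]` of the vertex `v` on the edge `e`, for `v` incident with `e`. -/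
def Orientation.pos (O : Orientation G) (v : V) (e : G.edgeSet) : unitInterval :=
  if O.tgt e = v then 1 else 0

/-- `C²[0,1]^N` with the `CK` condition: continuity at each vertex, and the Kirchhoff flow
condition (the outer normal derivatives at each vertex sum to zero). -/
def domCK (O : Orientation G) : Submodule ℂ (G.edgeSet → unitInterval → ℂ) where
  carrier := {u | (∀ e, IsC2 (u e)) ∧
    (∀ (v : V) (e f : G.edgeSet), v ∈ (e : Sym2 V) → v ∈ (f : Sym2 V) →
      u e (O.pos v e) = u f (O.pos v f)) ∧
    ∀ v : V, ∑ e : G.edgeSet, O.inc v e * d1 (u e) (O.pos v e) = 0}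
  zero_mem' := ⟨fun _ => IsC2.zero, fun _ _ _ _ _ => rfl, fun v => by simp [d1_zero]⟩
  add_mem' := by
    rintro u w ⟨hu, hu1, hu2⟩ ⟨hw, hw1, hw2⟩
    refine ⟨fun e => (hu e).add (hw e), fun v e f he hf => ?_, fun v => ?_⟩
    · simp only [Pi.add_apply]
      rw [hu1 v e f he hf, hw1 v e f he hf]
    · simp only [Pi.add_apply, d1_add (hu _) (hw _), mul_add, Finset.sum_add_distrib, hu2, hw2,
        add_zero]
  smul_mem' := by
    rintro a u ⟨hu, hu1, hu2⟩
    refine ⟨fun e => (hu e).smul a, fun v e f he hf => ?_, fun v => ?_⟩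
    · simp only [Pi.smul_apply]
      rw [hu1 v e f he hf]
    · simp only [Pi.smul_apply, d1_smul a (hu _), mul_left_comm _ a, ← Finset.mul_sum, hu2,
        mul_zero]

/-- `C²[0,1]^N` with the `KC` (anti-Kirchhoff) condition: at each vertex the values along the
incident edges sum to zero, and the outer normal derivatives coincide. -/
def domKC (O : Orientation G) : Submodule ℂ (G.edgeSet → unitInterval → ℂ) where
  carrier := {u | (∀ e, IsC2 (u e)) ∧
    (∀ v : V, ∑ e : G.edgeSet, O.inc v e ^ 2 * u e (O.pos v e) = 0) ∧
    ∀ (v : V) (e f : G.edgeSet), v ∈ (e : Sym2 V) → v ∈ (f : Sym2 V) →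
      O.inc v e * d1 (u e) (O.pos v e) = O.inc v f * d1 (u f) (O.pos v f)}
  zero_mem' := ⟨fun _ => IsC2.zero, fun v => by simp, fun _ _ _ _ _ => by simp [d1_zero]⟩
  add_mem' := by
    rintro u w ⟨hu, hu1, hu2⟩ ⟨hw, hw1, hw2⟩
    refine ⟨fun e => (hu e).add (hw e), fun v => ?_, fun v e f he hf => ?_⟩
    · simp only [Pi.add_apply, mul_add, Finset.sum_add_distrib, hu1, hw1, add_zero]
    · simp only [Pi.add_apply, d1_add (hu _) (hw _), mul_add]
      rw [hu2 v e f he hf, hw2 v e f he hf]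
  smul_mem' := by
    rintro a u ⟨hu, hu1, hu2⟩
    refine ⟨fun e => (hu e).smul a, fun v => ?_, fun v e f he hf => ?_⟩
    · simp only [Pi.smul_apply, smul_eq_mul, mul_left_comm _ a, ← Finset.mul_sum, hu1, mul_zero]
    · simp only [Pi.smul_apply, d1_smul a (hu _), mul_left_comm _ a]
      rw [hu2 v e f he hf]

/-- The edgewise second derivative, as an operator whose domain consists of `C²` functions. -/
def secondDeriv (D : Submodule ℂ (G.edgeSet → unitInterval → ℂ))
    (hD : ∀ u ∈ D, ∀ e, IsC2 (u e)) :
    (G.edgeSet → unitInterval → ℂ) →ₗ.[ℂ] (G.edgeSet → unitInterval → ℂ) where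
  domain := D
  toFun :=
    { toFun := fun u e => d2 ((u : G.edgeSet → unitInterval → ℂ) e)
      map_add' := fun u w => by
        funext e x
        exact d2_add (hD u u.2 e) (hD w w.2 e) x
      map_smul' := fun a u => by
        funext e x
        exact d2_smul a (hD u u.2 e) x }

/-- The Laplacian `Δ^{CK}`. -/
def laplacianCK (O : Orientation G) :
    (G.edgeSet → unitInterval → ℂ) →ₗ.[ℂ] (G.edgeSet → unitInterval → ℂ) :=
  secondDeriv (domCK O) fun _ hu => hu.1

/-- The Laplacian `Δ^{KC}`. -/
def laplacianKC (O : Orientation G) :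
    (G.edgeSet → unitInterval → ℂ) →ₗ.[ℂ] (G.edgeSet → unitInterval → ℂ) :=
  secondDeriv (domKC O) fun _ hu => hu.1

end

section Spectrum

variable {E : Type*} [AddCommGroup E] [Module ℂ E]

/-- The space `{u ∈ dom L | -L u = μ u}`. -/
def eigenspaceNeg (L : E →ₗ.[ℂ] E) (μ : ℂ) : Submodule ℂ L.domain :=
  LinearMap.ker (-L.toFun - μ • L.domain.subtype)

/-- The multiplicity of `μ` as an eigenvalue of `-L` (`0` if `μ` is not an eigenvalue). -/
noncomputable def multNeg (L : E →ₗ.[ℂ] E) (μ : ℂ) : ℕ := Module.finrank ℂ (eigenspaceNeg L μ)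

/-- `-L` and `-L'` have the same eigenvalues with the same multiplicities. -/
def Isospectral {E' : Type*} [AddCommGroup E'] [Module ℂ E'] (L : E →ₗ.[ℂ] E)
    (L' : E' →ₗ.[ℂ] E') : Prop :=
  ∀ μ : ℂ, multNeg L μ = multNeg L' μ

end Spectrum

section Invariants

variable {V : Type*}

/-- Number of connected components. -/
noncomputable def numComp (G : SimpleGraph V) : ℕ := Nat.card G.ConnectedComponent

/-- Number of bipartite connected components. -/
noncomputable def numBipComp (G : SimpleGraph V) : ℕ :=
  Nat.card {C : G.ConnectedComponent // C.toSimpleGraph.IsBipartite}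

/-- Number of non-bipartite connected components. -/
noncomputable def numNonBipComp (G : SimpleGraph V) : ℕ :=
  Nat.card {C : G.ConnectedComponent // ¬ C.toSimpleGraph.IsBipartite}

/-- The complexity: number of spanning trees. -/
noncomputable def complexity (G : SimpleGraph V) : ℕ :=
  Nat.card {T : SimpleGraph V // T ≤ G ∧ T.IsTree}

/-- The multiset of vertex degrees. -/
def degrees [Fintype V] (G : SimpleGraph V) [DecidableRel G.Adj] : Multiset ℕ :=
  (Finset.univ : Finset V).val.map fun v => G.degree v

/-- The circuit `0-1-2-3-0` of length `4` with the two paths `0-4-5` and `0-6-7` of length `2`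
glued to the vertex `0`. -/
def squareWithTwoPaths : SimpleGraph (Fin 8) where
  Adj a b := s(a, b) ∈ ({s(0, 1), s(1, 2), s(2, 3), s(3, 0), s(0, 4), s(4, 5), s(0, 6), s(6, 7)} :
    Finset (Sym2 (Fin 8)))
  symm := ⟨fun a b h => by rwa [Sym2.eq_swap (a := b)]⟩
  loopless := ⟨by decide⟩

instance : DecidableRel squareWithTwoPaths.Adj := fun a b =>
  inferInstanceAs (Decidable (s(a, b) ∈ ({s(0, 1), s(1, 2), s(2, 3), s(3, 0), s(0, 4), s(4, 5),
    s(0, 6), s(6, 7)} : Finset (Sym2 (Fin 8)))))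

end Invariants

end QGraph

/-! A solution of `-u'' = ω² u` on an edge is determined by `u(0)` and `u'(0)`. If `sin ω ≠ 0`, then
it is also determined by its values, or by its derivatives, at the two end points. The `CK`
conditions then say that the values at the vertices form an eigenfunction of the transition matrix
`D⁻¹ A` for the eigenvalue `cos ω`, and the `KC` conditions that the outer derivatives form one for
`-cos ω`. If `sin ω = 0`, then a solution is given by an eigenfunction for `± 1` together with an
element of the kernel of the signed or the unsigned incidence matrix, and the dimension of this
kernel brings in the number of edges; for `ω = 0` the solutions are affine, and one of these two
parts is missing. Hence isospectrality for either operator amounts to having equally many edges and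
isospectral transition matrices. The transition matrix is diagonalizable, so its multiplicities sum
to the number of vertices, and those of `1` and `-1` count the components and the bipartite
components. -/

namespace QGraph

open Set Matrix SimpleGraph
open Module (finrank)

noncomputable section

section Solutions

/-- The solution of `f'' = -ω² f` with `f 0 = 1` and `f' 0 = 0`. -/
def cosSol (ω : ℂ) (x : ℝ) : ℂ := Complex.cos (ω * x)

/-- The solution of `f'' = -ω² f` with `f 0 = 0` and `f' 0 = 1`. -/
def sinSol (ω : ℂ) (x : ℝ) : ℂ := if ω = 0 then (x : ℂ) else Complex.sin (ω * x) / ω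

/-- The solution of `f'' = -ω² f` with `f 0 = a` and `f' 0 = b`. -/
def sol (ω a b : ℂ) (x : ℝ) : ℂ := a * cosSol ω x + b * sinSol ω x

theorem cosSol_zero (ω : ℂ) : cosSol ω 0 = 1 := by simp [cosSol]

theorem sinSol_zero (ω : ℂ) : sinSol ω 0 = 0 := by simp [sinSol]

theorem cosSol_zero_left (x : ℝ) : cosSol 0 x = 1 := by simp [cosSol]

theorem sinSol_zero_left (x : ℝ) : sinSol 0 x = x := if_pos rfl

theorem cosSol_sq_add_sinSol_sq (ω : ℂ) (x : ℝ) :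
    cosSol ω x ^ 2 + ω ^ 2 * sinSol ω x ^ 2 = 1 := by
  unfold cosSol sinSol
  split_ifs with h
  · simp [h]
  · rw [div_pow, mul_div_cancel₀ _ (pow_ne_zero 2 h), add_comm]
    exact Complex.sin_sq_add_cos_sq _

theorem hasDerivAt_mul_ofReal (ω : ℂ) (x : ℝ) : HasDerivAt (fun y : ℝ => ω * (y : ℂ)) ω x := by
  simpa using (Complex.ofRealCLM.hasDerivAt (x := x)).const_mul ω

theorem hasDerivAt_cosSol (ω : ℂ) (x : ℝ) :
    HasDerivAt (cosSol ω) (-ω ^ 2 * sinSol ω x) x := by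
  refine ((Complex.hasDerivAt_cos (ω * x)).comp x (hasDerivAt_mul_ofReal ω x)).congr_deriv ?_
  unfold sinSol
  split_ifs with hω
  · simp [hω]
  · field_simp

theorem hasDerivAt_sinSol (ω : ℂ) (x : ℝ) : HasDerivAt (sinSol ω) (cosSol ω x) x := by
  by_cases hω : ω = 0
  · subst hω
    rw [cosSol_zero_left, funext sinSol_zero_left]
    exact Complex.ofRealCLM.hasDerivAt
  · have hsin : sinSol ω = fun y : ℝ => Complex.sin (ω * y) / ω := funext fun _ => if_neg hω
    rw [hsin]
    refine (((Complex.hasDerivAt_sin (ω * x)).comp x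
      (hasDerivAt_mul_ofReal ω x)).div_const ω).congr_deriv ?_
    rw [cosSol, mul_div_cancel_right₀ _ hω]

theorem hasDerivAt_sol (ω a b : ℂ) (x : ℝ) :
    HasDerivAt (sol ω a b) (sol ω b (-ω ^ 2 * a) x) x := by
  refine (((hasDerivAt_cosSol ω x).const_mul a).add
    ((hasDerivAt_sinSol ω x).const_mul b)).congr_deriv ?_
  rw [sol]
  ring

theorem deriv_sol (ω a b : ℂ) : deriv (sol ω a b) = sol ω b (-ω ^ 2 * a) :=
  funext fun x => (hasDerivAt_sol ω a b x).deriv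

theorem differentiable_sol (ω a b : ℂ) : Differentiable ℝ (sol ω a b) :=
  fun x => (hasDerivAt_sol ω a b x).differentiableAt

theorem contDiff_two_sol (ω a b : ℂ) : ContDiff ℝ 2 (sol ω a b) := by
  rw [← one_add_one_eq_two, contDiff_succ_iff_deriv]
  refine ⟨differentiable_sol ω a b, by simp, ?_⟩
  rw [deriv_sol, contDiff_one_iff_deriv, deriv_sol]
  exact ⟨differentiable_sol _ _ _, (differentiable_sol _ _ _).continuous⟩

theorem sol_neg_sq_mul (ω a b : ℂ) (x : ℝ) :
    sol ω (-ω ^ 2 * a) (-ω ^ 2 * b) x = -ω ^ 2 * sol ω a b x := by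
  simp only [sol]
  ring

theorem eq_of_hasDerivWithinAt_zero {g : ℝ → ℂ} {a b : ℝ}
    (hg : ∀ x ∈ Icc a b, HasDerivWithinAt g 0 (Icc a b) x) {x : ℝ} (hx : x ∈ Icc a b) :
    g x = g a :=
  constant_of_has_deriv_right_zero (fun y hy => (hg y hy).continuousWithinAt)
    (fun y hy => (hg y (Ico_subset_Icc_self hy)).mono_of_mem_nhdsWithin
      (Icc_mem_nhdsGE_of_mem hy)) x hx

theorem eqOn_sol_of_hasDerivWithinAt {ω : ℂ} {f f' : ℝ → ℂ} {r : ℝ}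
    (hf : ∀ x ∈ Icc 0 r, HasDerivWithinAt f (f' x) (Icc 0 r) x)
    (hf' : ∀ x ∈ Icc 0 r, HasDerivWithinAt f' (-ω ^ 2 * f x) (Icc 0 r) x) :
    EqOn f (sol ω (f 0) (f' 0)) (Icc 0 r) := by
  intro x hx
  have hvalue : f x * cosSol ω x - f' x * sinSol ω x = f 0 := by
    have h := eq_of_hasDerivWithinAt_zero (g := fun x => f x * cosSol ω x - f' x * sinSol ω x)
      (fun y hy => (((hf y hy).mul (hasDerivAt_cosSol ω y).hasDerivWithinAt).sub
        ((hf' y hy).mul (hasDerivAt_sinSol ω y).hasDerivWithinAt)).congr_deriv (by ring)) hx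
    simpa only [cosSol_zero, sinSol_zero, mul_one, mul_zero, sub_zero] using h
  have hslope : f' x * cosSol ω x + ω ^ 2 * (f x * sinSol ω x) = f' 0 := by
    have h := eq_of_hasDerivWithinAt_zero
      (g := fun x => f' x * cosSol ω x + ω ^ 2 * (f x * sinSol ω x))
      (fun y hy => (((hf' y hy).mul (hasDerivAt_cosSol ω y).hasDerivWithinAt).add
        (((hf y hy).mul (hasDerivAt_sinSol ω y).hasDerivWithinAt).const_mul
          (ω ^ 2))).congr_deriv (by ring)) hx
    simpa only [cosSol_zero, sinSol_zero, mul_one, mul_zero, add_zero] using h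
  rw [sol, ← hvalue, ← hslope]
  linear_combination (-f x) * cosSol_sq_add_sinSol_sq ω x

theorem exists_cosSol_eq (l : ℂ) : ∃ ω, cosSol ω 1 = l := by
  obtain ⟨ω, hω⟩ := Complex.cos_surjective l
  exact ⟨ω, by simpa [cosSol] using hω⟩

theorem cosSol_sq_eq_one {ω : ℂ} (h : sinSol ω 1 = 0) : cosSol ω 1 ^ 2 = 1 := by
  simpa [h] using cosSol_sq_add_sinSol_sq ω 1

theorem cosSol_pi : cosSol Real.pi 1 = -1 := by simp [cosSol]

theorem sinSol_pi : sinSol Real.pi 1 = 0 := by simp [sinSol]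

theorem cosSol_two_pi : cosSol (2 * Real.pi) 1 = 1 := by simp [cosSol]

theorem sinSol_two_pi : sinSol (2 * Real.pi) 1 = 0 := by simp [sinSol]

end Solutions

section Edge

theorem ext_coe (f : unitInterval → ℂ) (x : unitInterval) : ext f x = f x := by
  simp [ext]

theorem d2_eq_derivWithin (f : unitInterval → ℂ) (x : unitInterval) :
    d2 f x = derivWithin (derivWithin (ext f) (Icc 0 1)) (Icc 0 1) x := by
  rw [d2, iteratedDerivWithin_succ, iteratedDerivWithin_one]

/-- The restriction of `sol ω a b` to `[0,1]`. -/
def edgeSol (ω a b : ℂ) (x : unitInterval) : ℂ := sol ω a b x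

theorem eqOn_ext_edgeSol (ω a b : ℂ) : EqOn (ext (edgeSol ω a b)) (sol ω a b) (Icc 0 1) :=
  fun x hx => ext_coe (edgeSol ω a b) ⟨x, hx⟩

theorem isC2_edgeSol (ω a b : ℂ) : IsC2 (edgeSol ω a b) :=
  (contDiff_two_sol ω a b).contDiffOn.congr (eqOn_ext_edgeSol ω a b)

theorem eqOn_derivWithin_ext_edgeSol (ω a b : ℂ) :
    EqOn (derivWithin (ext (edgeSol ω a b)) (Icc 0 1)) (sol ω b (-ω ^ 2 * a)) (Icc 0 1) := by
  intro x hx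
  rw [derivWithin_congr (eqOn_ext_edgeSol ω a b) (eqOn_ext_edgeSol ω a b hx)]
  exact (hasDerivAt_sol ω a b x).hasDerivWithinAt.derivWithin (uniqueDiffOn_Icc zero_lt_one x hx)

theorem d1_edgeSol (ω a b : ℂ) : d1 (edgeSol ω a b) = edgeSol ω b (-ω ^ 2 * a) :=
  funext fun x => eqOn_derivWithin_ext_edgeSol ω a b x.2

theorem d2_edgeSol (ω a b : ℂ) (x : unitInterval) :
    d2 (edgeSol ω a b) x = -ω ^ 2 * edgeSol ω a b x := by
  rw [d2_eq_derivWithin, derivWithin_congr (eqOn_derivWithin_ext_edgeSol ω a b)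
    (eqOn_derivWithin_ext_edgeSol ω a b x.2)]
  exact ((hasDerivAt_sol ω b _ x).hasDerivWithinAt.derivWithin
    (uniqueDiffOn_Icc zero_lt_one x x.2)).trans (sol_neg_sq_mul ω a b x)

theorem eq_edgeSol_of_d2_eq {ω : ℂ} {f : unitInterval → ℂ} (hf : IsC2 f)
    (h : ∀ x, d2 f x = -ω ^ 2 * f x) : f = edgeSol ω (f 0) (d1 f 0) := by
  have hext : EqOn (ext f) (sol ω (ext f 0) (d1 f 0)) (Icc 0 1) := by
    refine eqOn_sol_of_hasDerivWithinAt
      (fun x hx => (hf.differentiableOn two_ne_zero x hx).hasDerivWithinAt) fun x hx => ?_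
    have hf' : ContDiffOn ℝ 1 (derivWithin (ext f) (Icc 0 1)) (Icc 0 1) :=
      hf.derivWithin (uniqueDiffOn_Icc zero_lt_one) (by norm_num)
    refine (hf'.differentiableOn one_ne_zero x hx).hasDerivWithinAt.congr_deriv ?_
    rw [← d2_eq_derivWithin f ⟨x, hx⟩, h, ← ext_coe f ⟨x, hx⟩]
  have h0 : ext f 0 = f 0 := ext_coe f 0
  funext x
  rw [← ext_coe f x, hext x.2, h0, edgeSol]

theorem edgeSol_at_zero (ω a b : ℂ) : edgeSol ω a b 0 = a := by
  simp [edgeSol, sol, cosSol_zero, sinSol_zero]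

theorem edgeSol_at_one (ω a b : ℂ) : edgeSol ω a b 1 = a * cosSol ω 1 + b * sinSol ω 1 := rfl

end Edge

section GeometricMultiplicity

variable {n K : Type*} [Fintype n] [DecidableEq n] [Field K]

/-- The geometric multiplicity of `l` as an eigenvalue of `A`; it is `0` if `l` is no eigenvalue. -/
def geomMult (A : Matrix n n K) (l : K) : ℕ := finrank K (Module.End.eigenspace (toLin' A) l)

theorem mem_eigenspace_toLin' {A : Matrix n n K} {l : K} {φ : n → K} :
    φ ∈ Module.End.eigenspace (toLin' A) l ↔ A *ᵥ φ = l • φ := by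
  rw [Module.End.mem_eigenspace_iff, toLin'_apply]

theorem geomMult_eq_of_mul_eq_mul {A B P : Matrix n n K} (hP : IsUnit P) (h : P * A = B * P) :
    geomMult A = geomMult B := by
  funext l
  have hinj : Function.Injective P.mulVec := mulVec_injective_of_isUnit hP
  let e : (n → K) ≃ₗ[K] (n → K) := LinearEquiv.ofInjectiveEndo P.mulVecLin hinj
  have hmap : (Module.End.eigenspace (toLin' A) l).map (e : (n → K) →ₗ[K] (n → K)) =
      Module.End.eigenspace (toLin' B) l := by
    ext φ
    obtain ⟨ψ, rfl⟩ := e.surjective φ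
    have hB : B *ᵥ P *ᵥ ψ = P *ᵥ A *ᵥ ψ := by simp only [mulVec_mulVec, h]
    rw [Submodule.map_equiv_eq_comap_symm, Submodule.mem_comap]
    simp only [LinearEquiv.coe_coe, LinearEquiv.symm_apply_apply, mem_eigenspace_toLin']
    change _ ↔ B *ᵥ P *ᵥ ψ = l • P *ᵥ ψ
    rw [hB, ← mulVec_smul, hinj.eq_iff]
  rw [geomMult, geomMult, ← hmap, LinearEquiv.finrank_map_eq]

end GeometricMultiplicity

section Hermitian

variable {n : Type*} [Fintype n] [DecidableEq n]

theorem geomMult_eq_finrank_eigenspace_toEuclideanLin (A : Matrix n n ℂ) (l : ℂ) :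
    geomMult A l = finrank ℂ (Module.End.eigenspace (toEuclideanLin A) l) := by
  have hmap : (Module.End.eigenspace (toLin' A) l).map
      ((WithLp.linearEquiv 2 ℂ (n → ℂ)).symm : (n → ℂ) →ₗ[ℂ] EuclideanSpace ℂ n) =
      Module.End.eigenspace (toEuclideanLin A) l := by
    ext φ
    rw [Submodule.map_equiv_eq_comap_symm, Submodule.mem_comap, LinearEquiv.symm_symm,
      LinearEquiv.coe_coe, mem_eigenspace_toLin', Module.End.mem_eigenspace_iff,
      ← (WithLp.linearEquiv 2 ℂ (n → ℂ)).injective.eq_iff]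
    rfl
  rw [geomMult, ← hmap, LinearEquiv.finrank_map_eq]

theorem finsum_geomMult_of_isHermitian {A : Matrix n n ℂ} (hA : A.IsHermitian) :
    ∑ᶠ l, geomMult A l = Fintype.card n := by
  have hsymm : (toEuclideanLin A).IsSymmetric := isSymmetric_toEuclideanLin_iff.2 hA
  let ev (i : Fin (Fintype.card n)) : ℂ := hsymm.eigenvalues finrank_euclideanSpace i
  have hev (l : ℂ) : geomMult A l = (Finset.univ.filter (ev · = l)).card := by
    rw [geomMult_eq_finrank_eigenspace_toEuclideanLin]
    exact (hsymm.card_filter_eigenvalues_eq finrank_euclideanSpace l).symm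
  have hsupp : (Function.support fun l => (Finset.univ.filter (ev · = l)).card) ⊆
      Finset.univ.image ev := by
    intro l hl
    obtain ⟨i, hi⟩ := Finset.card_ne_zero.1 hl
    exact Finset.mem_coe.2 (Finset.mem_image.2 ⟨i, Finset.mem_univ i, (Finset.mem_filter.1 hi).2⟩)
  rw [finsum_congr hev, finsum_eq_sum_of_support_subset _ hsupp,
    ← Finset.card_eq_sum_card_image, Finset.card_univ, Fintype.card_fin]

end Hermitian

section VertexMatrix

variable {V E : Type*} [DecidableEq V]

/-- The `0`-`1` matrix with rows indexed by vertices and columns indexed by edges, in which the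
column of the edge `e` marks the vertex `p e`. -/
def vertexMatrix (p : E → V) : Matrix V E ℂ := (1 : Matrix V V ℂ).submatrix id p

theorem vertexMatrix_apply (p : E → V) (v : V) (e : E) :
    vertexMatrix p v e = if p e = v then 1 else 0 := by
  simp only [vertexMatrix, submatrix_apply, id_eq, one_apply, eq_comm]

theorem vertexMatrix_conjTranspose (p : E → V) : (vertexMatrix p)ᴴ = (vertexMatrix p)ᵀ := by
  simp [vertexMatrix, conjTranspose_submatrix, transpose_submatrix]

theorem vertexMatrix_transpose_mulVec [Fintype V] (p : E → V) (φ : V → ℂ) :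
    (vertexMatrix p)ᵀ *ᵥ φ = φ ∘ p := by
  funext e
  simp [mulVec, dotProduct, vertexMatrix_apply]

theorem vertexMatrix_mul_transpose [Fintype E] (p : E → V) :
    vertexMatrix p * (vertexMatrix p)ᵀ = diagonal (vertexMatrix p *ᵥ 1) := by
  ext v w
  simp only [mul_apply, transpose_apply, vertexMatrix_apply, diagonal_apply, mulVec, dotProduct]
  split_ifs with hvw
  · exact Finset.sum_congr rfl fun e _ => by simp [hvw]
  · exact Finset.sum_eq_zero fun e _ => by grind

end VertexMatrix

namespace Orientation

variable {V : Type*} {G : SimpleGraph V} (O : Orientation G)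

theorem adj (e : G.edgeSet) : G.Adj (O.src e) (O.tgt e) := by
  rw [← mem_edgeSet, O.mk_eq]
  exact e.2

theorem tgt_ne_src (e : G.edgeSet) : O.tgt e ≠ O.src e := (O.adj e).ne'

theorem mem_iff {v : V} {e : G.edgeSet} : v ∈ (e : Sym2 V) ↔ v = O.src e ∨ v = O.tgt e := by
  rw [← O.mk_eq, Sym2.mem_iff]

theorem tgt_src_eq_iff {v w : V} {e : G.edgeSet} :
    (O.tgt e = v ∧ O.src e = w ∨ O.src e = v ∧ O.tgt e = w) ↔ (e : Sym2 V) = s(v, w) := by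
  rw [← O.mk_eq, Sym2.eq_iff]
  tauto

theorem eq_zero_of_comp_src_of_comp_tgt {M : Type*} [Zero M] (hG : ∀ v, ∃ w, G.Adj v w)
    {φ : V → M} (hsrc : φ ∘ O.src = 0) (htgt : φ ∘ O.tgt = 0) : φ = 0 := by
  funext v
  obtain ⟨w, hw⟩ := hG v
  rcases (O.mem_iff (e := ⟨s(v, w), hw⟩)).1 (Sym2.mem_mk_left v w) with hv | hv
  · exact hv ▸ congrFun hsrc _
  · exact hv ▸ congrFun htgt _

variable [DecidableEq V]

theorem pos_tgt (e : G.edgeSet) : O.pos (O.tgt e) e = 1 := if_pos rfl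

theorem pos_src (e : G.edgeSet) : O.pos (O.src e) e = 0 := if_neg (O.tgt_ne_src e)

theorem inc_tgt (e : G.edgeSet) : O.inc (O.tgt e) e = 1 := if_pos rfl

theorem inc_src (e : G.edgeSet) : O.inc (O.src e) e = -1 :=
  (if_neg (O.tgt_ne_src e)).trans (if_pos rfl)

/-- Marks in each column the end point with parameter `1`. -/
abbrev tgtMatrix : Matrix V G.edgeSet ℂ := vertexMatrix O.tgt

/-- Marks in each column the end point with parameter `0`. -/
abbrev srcMatrix : Matrix V G.edgeSet ℂ := vertexMatrix O.src

theorem sum_inc_mul [Fintype G.edgeSet] (g : G.edgeSet → unitInterval → ℂ) (v : V) :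
    ∑ e, O.inc v e * g e (O.pos v e) =
      (O.tgtMatrix *ᵥ (g · 1) - O.srcMatrix *ᵥ (g · 0)) v := by
  simp only [Pi.sub_apply, mulVec, dotProduct, vertexMatrix_apply, ← Finset.sum_sub_distrib]
  refine Finset.sum_congr rfl fun e _ => ?_
  have := O.tgt_ne_src e
  unfold inc pos
  split_ifs <;> simp_all

theorem sum_inc_sq_mul [Fintype G.edgeSet] (g : G.edgeSet → unitInterval → ℂ) (v : V) :
    ∑ e, O.inc v e ^ 2 * g e (O.pos v e) =
      (O.tgtMatrix *ᵥ (g · 1) + O.srcMatrix *ᵥ (g · 0)) v := by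
  simp only [Pi.add_apply, mulVec, dotProduct, vertexMatrix_apply, ← Finset.sum_add_distrib]
  refine Finset.sum_congr rfl fun e _ => ?_
  have := O.tgt_ne_src e
  unfold inc pos
  split_ifs <;> simp_all

variable [Fintype V] [DecidableRel G.Adj]

theorem tgtMatrix_mul_srcMatrix_transpose_add :
    O.tgtMatrix * O.srcMatrixᵀ + O.srcMatrix * O.tgtMatrixᵀ = G.adjMatrix ℂ := by
  ext v w
  have hsummand (e : G.edgeSet) : O.tgtMatrix v e * O.srcMatrix w e +
      O.srcMatrix v e * O.tgtMatrix w e = if (e : Sym2 V) = s(v, w) then 1 else 0 := by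
    have := O.tgt_ne_src e
    simp only [← O.tgt_src_eq_iff, vertexMatrix_apply]
    grind
  simp only [Matrix.add_apply, mul_apply, transpose_apply, ← Finset.sum_add_distrib, hsummand,
    adjMatrix_apply]
  split_ifs with hvw
  · rw [Finset.sum_eq_single_of_mem (⟨s(v, w), hvw⟩ : G.edgeSet) (Finset.mem_univ _)
      fun e _ he => if_neg fun h => he (Subtype.ext h), if_pos rfl]
  · exact Finset.sum_eq_zero fun e _ => if_neg fun h => hvw (by simpa [h] using e.2)

theorem tgtMatrix_mul_transpose_add :
    O.tgtMatrix * O.tgtMatrixᵀ + O.srcMatrix * O.srcMatrixᵀ = G.degMatrix ℂ := by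
  have hdeg : O.tgtMatrix *ᵥ 1 + O.srcMatrix *ᵥ 1 = fun v => (G.degree v : ℂ) := by
    have h := congrArg (· *ᵥ (1 : V → ℂ)) O.tgtMatrix_mul_srcMatrix_transpose_add
    funext v
    simpa [add_mulVec, ← mulVec_mulVec, vertexMatrix_transpose_mulVec, Pi.one_comp]
      using congrFun h v
  rw [vertexMatrix_mul_transpose, vertexMatrix_mul_transpose, diagonal_add, degMatrix, ← hdeg]
  rfl

end Orientation

section TransitionMatrix

variable {V K : Type*} [Fintype V] [DecidableEq V] [Field K] (G : SimpleGraph V)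
  [DecidableRel G.Adj]

variable (K) in
/-- The transition matrix `D⁻¹ A` of the simple random walk; the row of an isolated vertex is
zero. -/
def transitionMatrix : Matrix V V K :=
  diagonal (fun v => (G.degree v : K)⁻¹) * G.adjMatrix K

variable {G}

theorem mem_eigenspace_transitionMatrix [CharZero K] (hG : ∀ v, 0 < G.degree v) {l : K}
    {φ : V → K} : φ ∈ Module.End.eigenspace (toLin' (transitionMatrix K G)) l ↔
      G.adjMatrix K *ᵥ φ = l • G.degMatrix K *ᵥ φ := by
  rw [mem_eigenspace_toLin', transitionMatrix, ← mulVec_mulVec, funext_iff, funext_iff]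
  refine forall_congr' fun v => ?_
  have hv : (G.degree v : K) ≠ 0 := Nat.cast_ne_zero.2 (hG v).ne'
  rw [mulVec_diagonal, inv_mul_eq_iff_eq_mul₀ hv]
  simp only [Pi.smul_apply, degMatrix_mulVec_apply, smul_eq_mul, mul_left_comm]

theorem finsum_geomMult_transitionMatrix (hG : ∀ v, 0 < G.degree v) :
    ∑ᶠ l, geomMult (transitionMatrix ℂ G) l = Fintype.card V := by
  let r (v : V) : ℂ := Real.sqrt (G.degree v)
  have hr_star (v : V) : star (r v) = r v := Complex.conj_ofReal _
  have hr_sq (v : V) : r v * r v = G.degree v := by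
    simp only [r, ← Complex.ofReal_mul, Real.mul_self_sqrt (Nat.cast_nonneg _),
      Complex.ofReal_natCast]
  have hr (v : V) : r v ≠ 0 :=
    left_ne_zero_of_mul (hr_sq v ▸ Nat.cast_ne_zero.2 (hG v).ne')
  let N : Matrix V V ℂ := diagonal r⁻¹ * G.adjMatrix ℂ * diagonal r⁻¹
  have hN : N.IsHermitian := by
    have hstar : star r⁻¹ = r⁻¹ := funext fun v => by simp [hr_star]
    have hA : (G.adjMatrix ℂ)ᴴ = G.adjMatrix ℂ := G.isHermitian_adjMatrix ℂ
    rw [IsHermitian, conjTranspose_mul, conjTranspose_mul, diagonal_conjTranspose, hstar, hA,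
      ← Matrix.mul_assoc]
  have hsim : diagonal r * transitionMatrix ℂ G = N * diagonal r := by
    ext v w
    simp only [N, transitionMatrix, diagonal_mul, mul_diagonal, Pi.inv_apply, ← hr_sq]
    field_simp [hr v, hr w]
  have hunit : IsUnit (diagonal r) := isUnit_diagonal.2 (Pi.isUnit_iff.2 fun v => (hr v).isUnit)
  rw [geomMult_eq_of_mul_eq_mul hunit hsim, finsum_geomMult_of_isHermitian hN]

end TransitionMatrix

section LinearAlgebra

theorem smul_eq_iff_eq_smul_of_sq_eq_one {R M : Type*} [Monoid R] [MulAction R M] {l : R}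
    (hl : l ^ 2 = 1) {x y : M} : l • x = y ↔ x = l • y := by
  constructor <;> rintro rfl <;> rw [smul_smul, ← sq, hl, one_smul]

theorem finrank_map_of_disjoint_ker {K E F : Type*} [Field K] [AddCommGroup E] [Module K E]
    [AddCommGroup F] [Module K F] {f : E →ₗ[K] F} {W : Submodule K E}
    (h : Disjoint W (LinearMap.ker f)) : finrank K (W.map f) = finrank K W := by
  rw [← LinearMap.range_domRestrict, LinearMap.finrank_range_of_inj]
  rwa [LinearMap.injective_domRestrict_iff]

theorem finrank_prod_submodule {K E F : Type*} [Field K] [AddCommGroup E] [Module K E]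
    [AddCommGroup F] [Module K F] [FiniteDimensional K E] [FiniteDimensional K F]
    (W : Submodule K E) (W' : Submodule K F) :
    finrank K (W.prod W') = finrank K W + finrank K W' := by
  have hrange : W.prod W' = LinearMap.range (W.subtype.prodMap W'.subtype) := by
    rw [LinearMap.range_prodMap, W.range_subtype, W'.range_subtype]
  rw [hrange, LinearMap.finrank_range_of_inj
    (W.injective_subtype.prodMap W'.injective_subtype), Module.finrank_prod]

theorem finrank_ker_mulVecLin_add_card {m n K : Type*} [Fintype m] [Fintype n] [Field K]
    (A : Matrix m n K) :
    finrank K (LinearMap.ker A.mulVecLin) + Fintype.card m =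
      Fintype.card n + finrank K (LinearMap.ker Aᵀ.mulVecLin) := by
  have h := A.mulVecLin.finrank_range_add_finrank_ker
  have h' := Aᵀ.mulVecLin.finrank_range_add_finrank_ker
  have hrank : finrank K (LinearMap.range Aᵀ.mulVecLin) = finrank K (LinearMap.range A.mulVecLin) :=
    A.rank_transpose
  rw [Module.finrank_pi] at h h'
  lia

end LinearAlgebra

namespace Orientation

variable {V : Type*} [DecidableEq V] {G : SimpleGraph V} (O : Orientation G)

/-- The signed incidence matrix for `l = 1` and the unsigned one, up to sign, for `l = -1`. -/
def incidence (l : ℂ) : Matrix V G.edgeSet ℂ := l • O.tgtMatrix - O.srcMatrix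

theorem incidence_conjTranspose {l : ℂ} (hl : l ^ 2 = 1) :
    (O.incidence l)ᴴ = (O.incidence l)ᵀ := by
  have hstar : star l = l := by rcases mul_self_eq_one_iff.1 (sq l ▸ hl) with rfl | rfl <;> simp
  rw [incidence, conjTranspose_sub, conjTranspose_smul, hstar, vertexMatrix_conjTranspose,
    vertexMatrix_conjTranspose, transpose_sub, transpose_smul]

variable [Fintype V]

theorem mem_ker_incidence_transpose {l : ℂ} (hl : l ^ 2 = 1) {φ : V → ℂ} :
    φ ∈ LinearMap.ker (O.incidence l)ᵀ.mulVecLin ↔ φ ∘ O.tgt = l • φ ∘ O.src := by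
  rw [LinearMap.mem_ker, mulVecLin_apply, incidence, transpose_sub, transpose_smul, sub_mulVec,
    smul_mulVec, vertexMatrix_transpose_mulVec, vertexMatrix_transpose_mulVec, sub_eq_zero]
  exact smul_eq_iff_eq_smul_of_sq_eq_one hl

variable [DecidableRel G.Adj]

theorem incidence_mul_transpose {l : ℂ} (hl : l ^ 2 = 1) :
    O.incidence l * (O.incidence l)ᵀ = G.degMatrix ℂ - l • G.adjMatrix ℂ := by
  rw [← O.tgtMatrix_mul_transpose_add, ← O.tgtMatrix_mul_srcMatrix_transpose_add, incidence,
    transpose_sub, transpose_smul]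
  simp only [Matrix.sub_mul, Matrix.mul_sub, Matrix.smul_mul, Matrix.mul_smul, smul_sub, smul_smul,
    ← sq, hl, one_smul, smul_add]
  abel

open scoped ComplexOrder in
theorem ker_incidence_transpose (hG : ∀ v, 0 < G.degree v) {l : ℂ} (hl : l ^ 2 = 1) :
    LinearMap.ker (O.incidence l)ᵀ.mulVecLin =
      Module.End.eigenspace (toLin' (transitionMatrix ℂ G)) l := by
  ext φ
  rw [LinearMap.mem_ker, mulVecLin_apply, mem_eigenspace_transitionMatrix hG,
    ← O.incidence_conjTranspose hl, ← self_mul_conjTranspose_mulVec_eq_zero,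
    O.incidence_conjTranspose hl, O.incidence_mul_transpose hl, sub_mulVec, smul_mulVec,
    sub_eq_zero]
  exact eq_comm.trans (smul_eq_iff_eq_smul_of_sq_eq_one hl)

theorem finrank_ker_incidence_add_card (hG : ∀ v, 0 < G.degree v) {l : ℂ} (hl : l ^ 2 = 1) :
    finrank ℂ (LinearMap.ker (O.incidence l).mulVecLin) + Fintype.card V =
      G.edgeFinset.card + geomMult (transitionMatrix ℂ G) l := by
  rw [finrank_ker_mulVecLin_add_card, O.ker_incidence_transpose hG hl, ← Set.toFinset_card]
  rfl

/-- The pairs consisting of vertex values `φ` and edge slopes `b` which are compatible with the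
transfer matrix `!![C, S; -M, C]`: along each edge it maps the initial data `(φ (src e), b e)` to
terminal data whose value is `φ (tgt e)`, and at each vertex the terminal slopes of the incoming
edges sum up to the initial slopes of the outgoing ones. -/
def transferSpace (C S M : ℂ) : Submodule ℂ ((V → ℂ) × (G.edgeSet → ℂ)) where
  carrier := {p | p.1 ∘ O.tgt = C • p.1 ∘ O.src + S • p.2 ∧
    O.tgtMatrix *ᵥ (C • p.2 - M • p.1 ∘ O.src) = O.srcMatrix *ᵥ p.2}
  zero_mem' := ⟨by ext; simp, by simp [Pi.zero_comp]⟩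
  add_mem' := by
    rintro p q ⟨hp, hp'⟩ ⟨hq, hq'⟩
    refine ⟨?_, ?_⟩
    · simp only [Prod.fst_add, Prod.snd_add, Pi.add_comp, hp, hq, smul_add]
      abel
    · simp only [Prod.fst_add, Prod.snd_add, mulVec_add, ← hp', ← hq', Pi.add_comp, smul_add,
        mulVec_sub]
      abel
  smul_mem' := by
    rintro c p ⟨hp, hp'⟩
    refine ⟨?_, ?_⟩
    · simp only [Prod.smul_fst, Prod.smul_snd, Pi.smul_comp, hp, smul_add, smul_comm c]
    · simp only [Prod.smul_fst, Prod.smul_snd, mulVec_smul, ← hp', Pi.smul_comp, smul_comm _ c,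
        ← smul_sub]

variable {O} {C S M : ℂ}

theorem mem_transferSpace {p : (V → ℂ) × (G.edgeSet → ℂ)} : p ∈ O.transferSpace C S M ↔
    p.1 ∘ O.tgt = C • p.1 ∘ O.src + S • p.2 ∧
      O.tgtMatrix *ᵥ (C • p.2 - M • p.1 ∘ O.src) = O.srcMatrix *ᵥ p.2 := Iff.rfl

theorem mem_transferSpace_zero {p : (V → ℂ) × (G.edgeSet → ℂ)} (hC : C ^ 2 = 1) :
    p ∈ O.transferSpace C 0 M ↔ p.1 ∈ LinearMap.ker (O.incidence C)ᵀ.mulVecLin ∧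
      O.incidence C *ᵥ p.2 = M • O.tgtMatrix *ᵥ (p.1 ∘ O.src) := by
  rw [mem_transferSpace, mem_ker_incidence_transpose _ hC, zero_smul, add_zero, mulVec_sub,
    mulVec_smul, mulVec_smul, incidence, sub_mulVec, smul_mulVec, sub_eq_iff_eq_add,
    sub_eq_iff_eq_add, add_comm]

theorem smul_slope_defect (hCS : C ^ 2 + M * S = 1) {φ : V → ℂ} {b : G.edgeSet → ℂ}
    (h : φ ∘ O.tgt = C • φ ∘ O.src + S • b) :
    S • (O.tgtMatrix *ᵥ (C • b - M • φ ∘ O.src) - O.srcMatrix *ᵥ b) =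
      C • G.degMatrix ℂ *ᵥ φ - G.adjMatrix ℂ *ᵥ φ := by
  have hb (N : Matrix V G.edgeSet ℂ) :
      S • N *ᵥ b = N *ᵥ (φ ∘ O.tgt) - C • N *ᵥ (φ ∘ O.src) := by
    rw [h, mulVec_add, mulVec_smul, mulVec_smul, add_sub_cancel_left]
  rw [← O.tgtMatrix_mul_transpose_add, ← O.tgtMatrix_mul_srcMatrix_transpose_add]
  simp only [add_mulVec, ← mulVec_mulVec, vertexMatrix_transpose_mulVec, mulVec_sub, mulVec_smul]
  linear_combination (norm := module) C • hb O.tgtMatrix - hb O.srcMatrix -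
    congrArg (· • O.tgtMatrix *ᵥ (φ ∘ O.src)) hCS

theorem finrank_transferSpace_of_ne_zero (hG : ∀ v, 0 < G.degree v) (hCS : C ^ 2 + M * S = 1)
    (hS : S ≠ 0) :
    finrank ℂ (O.transferSpace C S M) = geomMult (transitionMatrix ℂ G) C := by
  have hslope {φ : V → ℂ} {b : G.edgeSet → ℂ} (h : φ ∘ O.tgt = C • φ ∘ O.src + S • b) :
      O.tgtMatrix *ᵥ (C • b - M • φ ∘ O.src) = O.srcMatrix *ᵥ b ↔
        φ ∈ Module.End.eigenspace (toLin' (transitionMatrix ℂ G)) C := by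
    rw [mem_eigenspace_transitionMatrix hG, ← sub_eq_zero, ← smul_eq_zero_iff_right hS,
      smul_slope_defect hCS h, sub_eq_zero, eq_comm]
  have hdisj : Disjoint (O.transferSpace C S M)
      (LinearMap.ker (LinearMap.fst ℂ (V → ℂ) (G.edgeSet → ℂ))) := by
    refine LinearMap.disjoint_ker.2 fun p hp (hp0 : p.1 = 0) => Prod.ext hp0 ?_
    have h := hp.1
    rw [hp0, Pi.zero_comp, Pi.zero_comp, smul_zero, zero_add] at h
    exact (smul_eq_zero_iff_right hS).1 h.symm
  have hmap : (O.transferSpace C S M).map (LinearMap.fst ℂ (V → ℂ) (G.edgeSet → ℂ)) =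
      Module.End.eigenspace (toLin' (transitionMatrix ℂ G)) C := by
    ext φ
    refine ⟨?_, fun hφ => ?_⟩
    · rintro ⟨p, hp, rfl⟩
      exact (hslope hp.1).1 hp.2
    · have h : φ ∘ O.tgt = C • φ ∘ O.src + S • S⁻¹ • (φ ∘ O.tgt - C • φ ∘ O.src) := by
        rw [smul_inv_smul₀ hS, add_sub_cancel]
      exact ⟨(φ, S⁻¹ • (φ ∘ O.tgt - C • φ ∘ O.src)), ⟨h, (hslope h).2 hφ⟩, rfl⟩
  rw [← finrank_map_of_disjoint_ker hdisj, hmap, geomMult]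

theorem finrank_transferSpace_zero_zero_add_card (hG : ∀ v, 0 < G.degree v) (hC : C ^ 2 = 1) :
    finrank ℂ (O.transferSpace C 0 0) + Fintype.card V =
      G.edgeFinset.card + 2 * geomMult (transitionMatrix ℂ G) C := by
  have hprod : O.transferSpace C 0 0 = (LinearMap.ker (O.incidence C)ᵀ.mulVecLin).prod
      (LinearMap.ker (O.incidence C).mulVecLin) := by
    ext p
    rw [mem_transferSpace_zero hC, zero_smul]
    rfl
  have h := O.finrank_ker_incidence_add_card hG hC
  rw [hprod, finrank_prod_submodule, O.ker_incidence_transpose hG hC, ← geomMult]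
  lia

open scoped ComplexOrder in
theorem fst_eq_zero_of_mem_transferSpace_zero (hG : ∀ v, 0 < G.degree v) (hC : C ^ 2 = 1)
    (hM : M ≠ 0) {p : (V → ℂ) × (G.edgeSet → ℂ)} (hp : p ∈ O.transferSpace C 0 M) : p.1 = 0 := by
  obtain ⟨φ, b⟩ := p
  obtain ⟨hφ, hb⟩ := (mem_transferSpace_zero hC).1 hp
  have htgt : φ ∘ O.tgt = C • φ ∘ O.src := (O.mem_ker_incidence_transpose hC).1 hφ
  have hC0 : C ≠ 0 := fun h => by simp [h] at hC
  -- Pairing the slope condition with `φ` leaves `M` times the squared norm of `φ ∘ src`.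
  have hvec : star φ ᵥ* O.incidence C = 0 := by
    rw [LinearMap.mem_ker, mulVecLin_apply, ← O.incidence_conjTranspose hC] at hφ
    rw [← conjTranspose_conjTranspose (O.incidence C), ← star_mulVec, hφ, star_zero]
  have hpair : star φ ⬝ᵥ O.tgtMatrix *ᵥ (φ ∘ O.src) = 0 := by
    refine (smul_eq_zero_iff_right hM).1 ?_
    rw [← dotProduct_smul, ← hb, dotProduct_mulVec, hvec, zero_dotProduct]
  have hsrc : φ ∘ O.src = 0 := by
    have hstar : star φ ∘ O.tgt = star C • star (φ ∘ O.src) := by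
      rw [← star_smul, ← htgt]
      rfl
    rw [dotProduct_mulVec, ← mulVec_transpose, vertexMatrix_transpose_mulVec, hstar,
      smul_dotProduct] at hpair
    exact dotProduct_star_self_eq_zero.1
      ((smul_eq_zero_iff_right (star_ne_zero.2 hC0)).1 hpair)
  exact O.eq_zero_of_comp_src_of_comp_tgt (fun v => (G.degree_pos_iff_exists_adj v).1 (hG v)) hsrc
    (by rw [htgt, hsrc, smul_zero])

theorem finrank_transferSpace_zero_add_card (hG : ∀ v, 0 < G.degree v) (hC : C ^ 2 = 1)
    (hM : M ≠ 0) :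
    finrank ℂ (O.transferSpace C 0 M) + Fintype.card V =
      G.edgeFinset.card + geomMult (transitionMatrix ℂ G) C := by
  have hprod : O.transferSpace C 0 M =
      (⊥ : Submodule ℂ (V → ℂ)).prod (LinearMap.ker (O.incidence C).mulVecLin) := by
    ext p
    refine ⟨fun hp => ?_, fun hp => ?_⟩
    · have h := ((mem_transferSpace_zero hC).1 hp).2
      have hp1 := fst_eq_zero_of_mem_transferSpace_zero hG hC hM hp
      rw [hp1, Pi.zero_comp, mulVec_zero, smul_zero] at h
      exact ⟨hp1, h⟩
    · obtain ⟨hp1 : p.1 = 0, hp2 : O.incidence C *ᵥ p.2 = 0⟩ := hp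
      rw [mem_transferSpace_zero hC, hp1, hp2, Pi.zero_comp, mulVec_zero, smul_zero]
      exact ⟨zero_mem _, rfl⟩
  rw [hprod, finrank_prod_submodule, finrank_bot, zero_add,
    O.finrank_ker_incidence_add_card hG hC]

end Orientation

section NetworkSolutions

variable {E : Type*}

/-- The tuple of edgewise solutions of `u'' = -ω² u` with values `p.1` and derivatives `p.2` at the
parameter `0`. -/
def networkSol (ω : ℂ) : (E → ℂ) × (E → ℂ) →ₗ[ℂ] (E → unitInterval → ℂ) where
  toFun p e := edgeSol ω (p.1 e) (p.2 e)
  map_add' p q := by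
    ext e x
    simp only [edgeSol, sol, Prod.fst_add, Prod.snd_add, Pi.add_apply]
    ring
  map_smul' c p := by
    ext e x
    simp only [edgeSol, sol, Prod.smul_fst, Prod.smul_snd, Pi.smul_apply, smul_eq_mul,
      RingHom.id_apply]
    ring

theorem networkSol_apply (ω : ℂ) (p : (E → ℂ) × (E → ℂ)) (e : E) :
    networkSol ω p e = edgeSol ω (p.1 e) (p.2 e) := rfl

theorem networkSol_at_zero (ω : ℂ) (p : (E → ℂ) × (E → ℂ)) :
    (fun e => networkSol ω p e 0) = p.1 :=
  funext fun _ => edgeSol_at_zero _ _ _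

theorem networkSol_at_one (ω : ℂ) (p : (E → ℂ) × (E → ℂ)) :
    (fun e => networkSol ω p e 1) = cosSol ω 1 • p.1 + sinSol ω 1 • p.2 := by
  funext e
  simp only [networkSol_apply, edgeSol_at_one, Pi.add_apply, Pi.smul_apply, smul_eq_mul, mul_comm]

theorem d1_networkSol_at_zero (ω : ℂ) (p : (E → ℂ) × (E → ℂ)) :
    (fun e => d1 (networkSol ω p e) 0) = p.2 := by
  funext e
  rw [networkSol_apply, d1_edgeSol, edgeSol_at_zero]

theorem d1_networkSol_at_one (ω : ℂ) (p : (E → ℂ) × (E → ℂ)) :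
    (fun e => d1 (networkSol ω p e) 1) = cosSol ω 1 • p.2 - (ω ^ 2 * sinSol ω 1) • p.1 := by
  funext e
  simp only [networkSol_apply, d1_edgeSol, edgeSol_at_one, Pi.sub_apply, Pi.smul_apply,
    smul_eq_mul]
  ring

theorem networkSol_injective (ω : ℂ) : Function.Injective (networkSol (E := E) ω) := by
  intro p q h
  refine Prod.ext ?_ ?_
  · rw [← networkSol_at_zero ω p, h, networkSol_at_zero]
  · rw [← d1_networkSol_at_zero ω p, h, d1_networkSol_at_zero]

theorem multNeg_secondDeriv {V : Type*} {G : SimpleGraph V}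
    (D : Submodule ℂ (G.edgeSet → unitInterval → ℂ)) (hD : ∀ u ∈ D, ∀ e, IsC2 (u e)) (ω : ℂ) :
    multNeg (secondDeriv D hD) (ω ^ 2) = finrank ℂ (D.comap (networkSol ω)) := by
  have hmem (u : D) : u ∈ eigenspaceNeg (secondDeriv D hD) (ω ^ 2) ↔
      ∀ e x, d2 (u.1 e) x = -ω ^ 2 * u.1 e x := by
    change -(fun e => d2 (u.1 e)) - ω ^ 2 • u.1 = 0 ↔ _
    simp only [funext_iff, Pi.sub_apply, Pi.neg_apply, Pi.smul_apply, smul_eq_mul, Pi.zero_apply]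
    refine forall₂_congr fun e x => ⟨fun h => ?_, fun h => ?_⟩ <;> linear_combination -h
  have hmap : (eigenspaceNeg (secondDeriv D hD) (ω ^ 2)).map D.subtype =
      (D.comap (networkSol ω)).map (networkSol ω) := by
    ext u
    constructor
    · rintro ⟨u, hu, rfl⟩
      have hsol : networkSol ω (fun e => u.1 e 0, fun e => d1 (u.1 e) 0) = u.1 :=
        funext fun e => (eq_edgeSol_of_d2_eq (hD u u.2 e) ((hmem u).1 hu e)).symm
      exact ⟨_, by rw [SetLike.mem_coe, Submodule.mem_comap, hsol]; exact u.2, hsol⟩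
    · rintro ⟨p, hp, rfl⟩
      exact ⟨⟨networkSol ω p, hp⟩, (hmem _).2 fun e => d2_edgeSol ω _ _, rfl⟩
  refine (Submodule.finrank_map_subtype_eq D _).symm.trans ?_
  rw [hmap]
  exact (Submodule.equivMapOfInjective _ (networkSol_injective ω) _).finrank_eq.symm

end NetworkSolutions

namespace Orientation

variable {V : Type*} {G : SimpleGraph V} (O : Orientation G)

theorem forall_incident_eq_iff_exists {α : Type*} [Nonempty α] {g : V → G.edgeSet → α} :
    (∀ v (e f : G.edgeSet), v ∈ (e : Sym2 V) → v ∈ (f : Sym2 V) → g v e = g v f) ↔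
      ∃ φ : V → α, φ ∘ O.tgt = (fun e => g (O.tgt e) e) ∧ φ ∘ O.src = fun e => g (O.src e) e := by
  constructor
  · intro h
    have hvertex (v : V) : ∃ a, ∀ e : G.edgeSet, v ∈ (e : Sym2 V) → a = g v e := by
      by_cases hv : ∃ e : G.edgeSet, v ∈ (e : Sym2 V)
      · obtain ⟨e, he⟩ := hv
        exact ⟨g v e, fun f hf => h v e f he hf⟩
      · exact ⟨Classical.arbitrary α, fun e he => absurd ⟨e, he⟩ hv⟩
    choose φ hφ using hvertex
    exact ⟨φ, funext fun e => hφ _ e (O.mem_iff.2 (Or.inr rfl)),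
      funext fun e => hφ _ e (O.mem_iff.2 (Or.inl rfl))⟩
  · rintro ⟨φ, htgt, hsrc⟩
    have hφ (v : V) (e : G.edgeSet) (he : v ∈ (e : Sym2 V)) : φ v = g v e := by
      rcases O.mem_iff.1 he with rfl | rfl
      exacts [congrFun hsrc e, congrFun htgt e]
    exact fun v e f he hf => (hφ v e he).symm.trans (hφ v f hf)

variable [Fintype V] [DecidableEq V] [DecidableRel G.Adj]

theorem mem_domCK_iff {u : G.edgeSet → unitInterval → ℂ} : u ∈ domCK O ↔
    (∀ e, IsC2 (u e)) ∧ (∃ φ : V → ℂ, φ ∘ O.tgt = (u · 1) ∧ φ ∘ O.src = (u · 0)) ∧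
      O.tgtMatrix *ᵥ (fun e => d1 (u e) 1) = O.srcMatrix *ᵥ (fun e => d1 (u e) 0) := by
  refine and_congr_right' (and_congr ?_ ?_)
  · simp only [O.forall_incident_eq_iff_exists (g := fun v e => u e (O.pos v e)), pos_tgt, pos_src]
  · rw [← sub_eq_zero, funext_iff]
    exact forall_congr' fun v => by rw [O.sum_inc_mul fun e => d1 (u e), Pi.zero_apply]

theorem mem_domKC_iff {u : G.edgeSet → unitInterval → ℂ} : u ∈ domKC O ↔
    (∀ e, IsC2 (u e)) ∧ O.tgtMatrix *ᵥ (u · 1) + O.srcMatrix *ᵥ (u · 0) = 0 ∧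
      ∃ ψ : V → ℂ, ψ ∘ O.tgt = (fun e => d1 (u e) 1) ∧ ψ ∘ O.src = fun e => -d1 (u e) 0 := by
  refine and_congr_right' (and_congr ?_ ?_)
  · rw [funext_iff]
    exact forall_congr' fun v => by rw [O.sum_inc_sq_mul u, Pi.zero_apply]
  · simp only [O.forall_incident_eq_iff_exists (g := fun v e => O.inc v e * d1 (u e) (O.pos v e)),
      pos_tgt, pos_src, inc_tgt, inc_src, one_mul, neg_one_mul]

theorem comap_networkSol_domCK (ω : ℂ) :
    (domCK O).comap (networkSol ω) =
      (O.transferSpace (cosSol ω 1) (sinSol ω 1) (ω ^ 2 * sinSol ω 1)).map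
        ((LinearMap.funLeft ℂ ℂ O.src).prodMap LinearMap.id) := by
  ext p
  rw [Submodule.mem_comap, mem_domCK_iff, networkSol_at_zero, networkSol_at_one,
    d1_networkSol_at_zero, d1_networkSol_at_one]
  constructor
  · rintro ⟨-, ⟨φ, htgt, hsrc⟩, hflow⟩
    rw [← hsrc] at htgt hflow
    exact ⟨(φ, p.2), ⟨htgt, hflow⟩, Prod.ext hsrc rfl⟩
  · rintro ⟨q, ⟨htgt, hflow⟩, rfl⟩
    exact ⟨fun _ => isC2_edgeSol _ _ _, ⟨q.1, htgt, rfl⟩, hflow⟩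

theorem comap_networkSol_domKC (ω : ℂ) :
    (domKC O).comap (networkSol ω) =
      (O.transferSpace (-cosSol ω 1) (-(ω ^ 2 * sinSol ω 1)) (-sinSol ω 1)).map
        ((LinearMap.snd ℂ _ _).prod (-(LinearMap.funLeft ℂ ℂ O.src ∘ₗ LinearMap.fst ℂ _ _))) := by
  ext ⟨a, b⟩
  have hslope (ψ : G.edgeSet → ℂ) : cosSol ω 1 • -ψ - (ω ^ 2 * sinSol ω 1) • a =
      -cosSol ω 1 • ψ + -(ω ^ 2 * sinSol ω 1) • a := by module
  have hflow (ψ : G.edgeSet → ℂ) :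
      O.tgtMatrix *ᵥ (cosSol ω 1 • a + sinSol ω 1 • -ψ) + O.srcMatrix *ᵥ a = 0 ↔
        O.tgtMatrix *ᵥ (-cosSol ω 1 • a - -sinSol ω 1 • ψ) = O.srcMatrix *ᵥ a := by
    have hneg : -cosSol ω 1 • a - -sinSol ω 1 • ψ =
        -(cosSol ω 1 • a + sinSol ω 1 • -ψ) := by module
    rw [hneg, mulVec_neg, neg_eq_iff_add_eq_zero]
  have hpi (f : G.edgeSet → ℂ) : (fun e => -f e) = -f := rfl
  rw [Submodule.mem_comap, mem_domKC_iff, networkSol_at_zero, networkSol_at_one,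
    d1_networkSol_at_one]
  constructor
  · rintro ⟨-, hsum, ψ, htgt, hsrc⟩
    obtain rfl : b = -(ψ ∘ O.src) := by rw [hsrc, hpi, d1_networkSol_at_zero, neg_neg]
    exact ⟨(ψ, a), ⟨htgt.trans (hslope _), (hflow _).1 hsum⟩, rfl⟩
  · rintro ⟨⟨ψ, a⟩, ⟨htgt, hsum⟩, h⟩
    obtain ⟨rfl, rfl⟩ := Prod.mk.inj h
    refine ⟨fun _ => isC2_edgeSol _ _ _, (hflow _).2 hsum, ψ, htgt.trans (hslope _).symm, ?_⟩
    rw [hpi, d1_networkSol_at_zero]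
    exact (neg_neg _).symm

end Orientation

section Multiplicities

variable {V : Type*} [Fintype V] [DecidableEq V] {G : SimpleGraph V} [DecidableRel G.Adj]

theorem multNeg_laplacianCK_eq_finrank (hG : ∀ v, 0 < G.degree v) (O : Orientation G) (ω : ℂ) :
    multNeg (laplacianCK O) (ω ^ 2) =
      finrank ℂ (O.transferSpace (cosSol ω 1) (sinSol ω 1) (ω ^ 2 * sinSol ω 1)) := by
  rw [laplacianCK, multNeg_secondDeriv, O.comap_networkSol_domCK]
  refine finrank_map_of_disjoint_ker (LinearMap.disjoint_ker.2 fun p hp h => ?_)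
  obtain ⟨hsrc : p.1 ∘ O.src = 0, hb : p.2 = 0⟩ := Prod.mk.inj h
  refine Prod.ext (O.eq_zero_of_comp_src_of_comp_tgt
    (fun v => (G.degree_pos_iff_exists_adj v).1 (hG v)) hsrc ?_) hb
  rw [hp.1, hsrc, hb, smul_zero, smul_zero, add_zero]

theorem multNeg_laplacianKC_eq_finrank (hG : ∀ v, 0 < G.degree v) (O : Orientation G) (ω : ℂ) :
    multNeg (laplacianKC O) (ω ^ 2) =
      finrank ℂ (O.transferSpace (-cosSol ω 1) (-(ω ^ 2 * sinSol ω 1)) (-sinSol ω 1)) := by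
  rw [laplacianKC, multNeg_secondDeriv, O.comap_networkSol_domKC]
  refine finrank_map_of_disjoint_ker (LinearMap.disjoint_ker.2 fun p hp h => ?_)
  obtain ⟨ha : p.2 = 0, hneg : -(p.1 ∘ O.src) = 0⟩ := Prod.mk.inj h
  have hsrc := neg_eq_zero.1 hneg
  refine Prod.ext (O.eq_zero_of_comp_src_of_comp_tgt
    (fun v => (G.degree_pos_iff_exists_adj v).1 (hG v)) hsrc ?_) ha
  rw [hp.1, hsrc, ha, smul_zero, smul_zero, add_zero]

theorem multNeg_laplacianCK_of_sinSol_ne_zero (hG : ∀ v, 0 < G.degree v) (O : Orientation G)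
    {ω : ℂ} (hω : sinSol ω 1 ≠ 0) :
    multNeg (laplacianCK O) (ω ^ 2) = geomMult (transitionMatrix ℂ G) (cosSol ω 1) := by
  rw [multNeg_laplacianCK_eq_finrank hG, Orientation.finrank_transferSpace_of_ne_zero hG _ hω]
  linear_combination cosSol_sq_add_sinSol_sq ω 1

theorem multNeg_laplacianCK_add_card (hG : ∀ v, 0 < G.degree v) (O : Orientation G)
    {ω : ℂ} (hω : sinSol ω 1 = 0) :
    multNeg (laplacianCK O) (ω ^ 2) + Fintype.card V =
      G.edgeFinset.card + 2 * geomMult (transitionMatrix ℂ G) (cosSol ω 1) := by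
  rw [multNeg_laplacianCK_eq_finrank hG, hω, mul_zero,
    Orientation.finrank_transferSpace_zero_zero_add_card hG (cosSol_sq_eq_one hω)]

theorem multNeg_laplacianKC_of_sinSol_ne_zero (hG : ∀ v, 0 < G.degree v) (O : Orientation G)
    {ω : ℂ} (hω : ω ≠ 0) (hsin : sinSol ω 1 ≠ 0) :
    multNeg (laplacianKC O) (ω ^ 2) = geomMult (transitionMatrix ℂ G) (-cosSol ω 1) := by
  rw [multNeg_laplacianKC_eq_finrank hG, Orientation.finrank_transferSpace_of_ne_zero hG _
    (neg_ne_zero.2 (mul_ne_zero (pow_ne_zero 2 hω) hsin))]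
  linear_combination cosSol_sq_add_sinSol_sq ω 1

theorem multNeg_laplacianKC_add_card (hG : ∀ v, 0 < G.degree v) (O : Orientation G)
    {ω : ℂ} (hω : sinSol ω 1 = 0) :
    multNeg (laplacianKC O) (ω ^ 2) + Fintype.card V =
      G.edgeFinset.card + 2 * geomMult (transitionMatrix ℂ G) (-cosSol ω 1) := by
  rw [multNeg_laplacianKC_eq_finrank hG, hω, mul_zero, neg_zero,
    Orientation.finrank_transferSpace_zero_zero_add_card hG
      (by rw [neg_sq, cosSol_sq_eq_one hω])]

theorem multNeg_laplacianKC_zero_add_card (hG : ∀ v, 0 < G.degree v) (O : Orientation G) :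
    multNeg (laplacianKC O) 0 + Fintype.card V =
      G.edgeFinset.card + geomMult (transitionMatrix ℂ G) (-1) := by
  have h := multNeg_laplacianKC_eq_finrank hG O 0
  rw [zero_pow two_ne_zero, zero_mul, neg_zero, cosSol_zero_left, sinSol_zero_left] at h
  rw [h, Orientation.finrank_transferSpace_zero_add_card hG (by norm_num) (by norm_num)]

end Multiplicities

section Isospectrality

variable {V V' : Type*} [Fintype V] [DecidableEq V] [Fintype V'] [DecidableEq V']
  {G : SimpleGraph V} {G' : SimpleGraph V'} [DecidableRel G.Adj] [DecidableRel G'.Adj]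

theorem card_eq_of_geomMult_eq (hG : ∀ v, 0 < G.degree v) (hG' : ∀ v, 0 < G'.degree v)
    (h : ∀ l, geomMult (transitionMatrix ℂ G) l = geomMult (transitionMatrix ℂ G') l) :
    Fintype.card V = Fintype.card V' := by
  rw [← finsum_geomMult_transitionMatrix hG, ← finsum_geomMult_transitionMatrix hG', funext h]

theorem card_edgeFinset_eq_and_geomMult_eq (hG : ∀ v, 0 < G.degree v)
    (hG' : ∀ v, 0 < G'.degree v)
    (hcard : G.edgeFinset.card + Fintype.card V' = G'.edgeFinset.card + Fintype.card V)
    (hone : geomMult (transitionMatrix ℂ G) 1 = geomMult (transitionMatrix ℂ G') 1)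
    (hneg_one : geomMult (transitionMatrix ℂ G) (-1) = geomMult (transitionMatrix ℂ G') (-1))
    (h : ∀ l, l ^ 2 ≠ 1 →
      geomMult (transitionMatrix ℂ G) l = geomMult (transitionMatrix ℂ G') l) :
    G.edgeFinset.card = G'.edgeFinset.card ∧
      ∀ l, geomMult (transitionMatrix ℂ G) l = geomMult (transitionMatrix ℂ G') l := by
  have hmult (l : ℂ) : geomMult (transitionMatrix ℂ G) l = geomMult (transitionMatrix ℂ G') l := by
    by_cases hl : l ^ 2 = 1
    · rcases mul_self_eq_one_iff.1 (sq l ▸ hl) with rfl | rfl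
      exacts [hone, hneg_one]
    · exact h l hl
  have hV := card_eq_of_geomMult_eq hG hG' hmult
  exact ⟨by lia, hmult⟩

theorem isospectral_laplacianCK_iff (hG : ∀ v, 0 < G.degree v) (hG' : ∀ v, 0 < G'.degree v)
    (O : Orientation G) (O' : Orientation G') :
    Isospectral (laplacianCK O) (laplacianCK O') ↔ G.edgeFinset.card = G'.edgeFinset.card ∧
      ∀ l, geomMult (transitionMatrix ℂ G) l = geomMult (transitionMatrix ℂ G') l := by
  constructor
  · intro h
    have hsmooth {ω : ℂ} (hω : sinSol ω 1 ≠ 0) :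
        geomMult (transitionMatrix ℂ G) (cosSol ω 1) =
          geomMult (transitionMatrix ℂ G') (cosSol ω 1) := by
      rw [← multNeg_laplacianCK_of_sinSol_ne_zero hG O hω, h,
        multNeg_laplacianCK_of_sinSol_ne_zero hG' O' hω]
    have hone := hsmooth (ω := 0) (by simp [sinSol_zero_left])
    rw [cosSol_zero_left] at hone
    have hpi := multNeg_laplacianCK_add_card hG O sinSol_pi
    have hpi' := multNeg_laplacianCK_add_card hG' O' sinSol_pi
    have htwo_pi := multNeg_laplacianCK_add_card hG O sinSol_two_pi
    have htwo_pi' := multNeg_laplacianCK_add_card hG' O' sinSol_two_pi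
    rw [h, cosSol_pi] at hpi
    rw [h, cosSol_two_pi] at htwo_pi
    rw [cosSol_pi] at hpi'
    rw [cosSol_two_pi] at htwo_pi'
    refine card_edgeFinset_eq_and_geomMult_eq hG hG' (by lia) hone (by lia) fun l hl => ?_
    obtain ⟨ω, rfl⟩ := exists_cosSol_eq l
    exact hsmooth fun hω => hl (cosSol_sq_eq_one hω)
  · rintro ⟨hedges, h⟩ μ
    obtain ⟨ω, rfl⟩ := IsAlgClosed.exists_pow_nat_eq μ two_pos
    by_cases hω : sinSol ω 1 = 0
    · have hmult := multNeg_laplacianCK_add_card hG O hω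
      have hmult' := multNeg_laplacianCK_add_card hG' O' hω
      have hcard := card_eq_of_geomMult_eq hG hG' h
      rw [h] at hmult
      lia
    · rw [multNeg_laplacianCK_of_sinSol_ne_zero hG O hω, h,
        multNeg_laplacianCK_of_sinSol_ne_zero hG' O' hω]

theorem isospectral_laplacianKC_iff (hG : ∀ v, 0 < G.degree v) (hG' : ∀ v, 0 < G'.degree v)
    (O : Orientation G) (O' : Orientation G') :
    Isospectral (laplacianKC O) (laplacianKC O') ↔ G.edgeFinset.card = G'.edgeFinset.card ∧
      ∀ l, geomMult (transitionMatrix ℂ G) l = geomMult (transitionMatrix ℂ G') l := by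
  constructor
  · intro h
    have hzero := multNeg_laplacianKC_zero_add_card hG O
    have hzero' := multNeg_laplacianKC_zero_add_card hG' O'
    have hpi := multNeg_laplacianKC_add_card hG O sinSol_pi
    have hpi' := multNeg_laplacianKC_add_card hG' O' sinSol_pi
    have htwo_pi := multNeg_laplacianKC_add_card hG O sinSol_two_pi
    have htwo_pi' := multNeg_laplacianKC_add_card hG' O' sinSol_two_pi
    rw [h] at hzero hpi htwo_pi
    rw [cosSol_pi, neg_neg] at hpi hpi'
    rw [cosSol_two_pi] at htwo_pi htwo_pi'
    refine card_edgeFinset_eq_and_geomMult_eq hG hG' (by lia) (by lia) (by lia) fun l hl => ?_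
    obtain ⟨ω, hω⟩ := exists_cosSol_eq (-l)
    have hω0 : ω ≠ 0 := by
      rintro rfl
      rw [cosSol_zero_left] at hω
      exact hl (by rw [← neg_sq, ← hω, one_pow])
    have hsin : sinSol ω 1 ≠ 0 := fun h0 => hl (by rw [← neg_sq, ← hω, cosSol_sq_eq_one h0])
    rw [← neg_neg l, ← hω, ← multNeg_laplacianKC_of_sinSol_ne_zero hG O hω0 hsin, h,
      multNeg_laplacianKC_of_sinSol_ne_zero hG' O' hω0 hsin]
  · rintro ⟨hedges, h⟩ μ
    have hcard := card_eq_of_geomMult_eq hG hG' h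
    obtain ⟨ω, rfl⟩ := IsAlgClosed.exists_pow_nat_eq μ two_pos
    by_cases hω0 : ω = 0
    · have hmult := multNeg_laplacianKC_zero_add_card hG O
      have hmult' := multNeg_laplacianKC_zero_add_card hG' O'
      rw [h] at hmult
      rw [hω0, zero_pow two_ne_zero]
      lia
    by_cases hω : sinSol ω 1 = 0
    · have hmult := multNeg_laplacianKC_add_card hG O hω
      have hmult' := multNeg_laplacianKC_add_card hG' O' hω
      rw [h] at hmult
      lia
    · rw [multNeg_laplacianKC_of_sinSol_ne_zero hG O hω0 hω, h,
        multNeg_laplacianKC_of_sinSol_ne_zero hG' O' hω0 hω]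

end Isospectrality

section TwistedFunctions

variable {V K : Type*} [Field K] {G : SimpleGraph V}

variable (G) in
/-- The functions on the vertices which are multiplied by `l` along each edge: the locally constant
functions for `l = 1`, the functions changing sign along each edge for `l = -1`. -/
def twistedFunctions (l : K) : Submodule K (V → K) where
  carrier := {φ | ∀ u v, G.Adj u v → φ v = l * φ u}
  zero_mem' _ _ _ := (mul_zero l).symm
  add_mem' hφ hψ u v huv := by
    rw [Pi.add_apply, Pi.add_apply, hφ u v huv, hψ u v huv, mul_add]
  smul_mem' c φ hφ u v huv := by
    rw [Pi.smul_apply, Pi.smul_apply, hφ u v huv, smul_eq_mul, smul_eq_mul, mul_left_comm]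

theorem eq_of_reachable {α : Type*} {f : V → α} (hf : ∀ u v, G.Adj u v → f u = f v) {u v : V} :
    G.Reachable u v → f u = f v := by
  rintro ⟨p⟩
  induction p with
  | nil => rfl
  | cons huv _ ih => exact (hf _ _ huv).trans ih

theorem div_eq_div_of_reachable {l : K} (hl : l ≠ 0) {φ ψ : V → K} (hφ : φ ∈ twistedFunctions G l)
    (hψ : ψ ∈ twistedFunctions G l) {u v : V} (huv : G.Reachable u v) :
    φ u / ψ u = φ v / ψ v :=
  eq_of_reachable (f := fun v => φ v / ψ v)
    (fun u v huv => by rw [hφ u v huv, hψ u v huv, mul_div_mul_left _ _ hl]) huv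

theorem glue_mem_twistedFunctions {l : K} {ψ : G.ConnectedComponent → V → K}
    (hψ : ∀ C, ψ C ∈ twistedFunctions G l) :
    (fun v => ψ (G.connectedComponentMk v) v) ∈ twistedFunctions G l := fun u v huv => by
  change ψ (G.connectedComponentMk v) v = l * ψ (G.connectedComponentMk u) u
  rw [ConnectedComponent.connectedComponentMk_eq_of_adj huv, hψ _ u v huv]

theorem finrank_twistedFunctions [Finite V] {l : K} (hl : l ≠ 0) {p : G.ConnectedComponent → Prop}
    (hp : ∀ φ ∈ twistedFunctions G l, ∀ v, φ v ≠ 0 → p (G.connectedComponentMk v))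
    (hp' : ∀ C, p C → ∃ φ ∈ twistedFunctions G l, ∀ v ∈ C, φ v ≠ 0) :
    finrank K (twistedFunctions G l) = Nat.card {C // p C} := by
  classical
  choose ε hε hε0 using hp'
  let rep (C : {C // p C}) : V := C.1.out
  have hrep (C : {C // p C}) : G.connectedComponentMk (rep C) = C.1 := Quot.out_eq C.1
  have hinj : Function.Injective
      ((LinearMap.funLeft K K rep).domRestrict (twistedFunctions G l)) := by
    refine (injective_iff_map_eq_zero _).2 fun φ hφ => Subtype.ext (funext fun v => ?_)
    by_contra hv
    let C : {C // p C} := ⟨G.connectedComponentMk v, hp φ φ.2 v hv⟩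
    have hφrep : φ.1 (rep C) = 0 := congrFun hφ C
    have hratio := div_eq_div_of_reachable hl φ.2 (hε C.1 C.2)
      (ConnectedComponent.exact (hrep C).symm)
    rw [hφrep, zero_div] at hratio
    exact div_ne_zero hv (hε0 C.1 C.2 v rfl) hratio
  have hsurj : Function.Surjective
      ((LinearMap.funLeft K K rep).domRestrict (twistedFunctions G l)) := by
    intro x
    let ψ (C : G.ConnectedComponent) : twistedFunctions G l :=
      if h : p C then (x ⟨C, h⟩ / ε C h (rep ⟨C, h⟩)) • ⟨ε C h, hε C h⟩ else 0
    refine ⟨⟨_, glue_mem_twistedFunctions fun C => (ψ C).2⟩, funext fun C => ?_⟩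
    change (ψ (G.connectedComponentMk (rep C))).1 (rep C) = x C
    rw [hrep, show ψ C.1 = _ from dif_pos C.2]
    exact div_mul_cancel₀ _ (hε0 _ _ _ (hrep C))
  rw [(LinearEquiv.ofBijective _ ⟨hinj, hsurj⟩).finrank_eq]
  have := Fintype.ofFinite {C // p C}
  rw [Module.finrank_pi, Nat.card_eq_fintype_card]

theorem finrank_twistedFunctions_one [Finite V] :
    finrank K (twistedFunctions G (1 : K)) = numComp G := by
  rw [finrank_twistedFunctions (p := fun _ => True) one_ne_zero (fun _ _ _ _ => trivial)
    fun _ _ => ⟨1, fun _ _ _ => (mul_one _).symm, fun _ _ => one_ne_zero⟩, numComp]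
  exact Nat.card_congr (Equiv.subtypeUnivEquiv fun _ => trivial)

theorem isBipartite_of_mem_twistedFunctions [NeZero (2 : K)] {φ : V → K}
    (hφ : φ ∈ twistedFunctions G (-1)) {v : V} (hv : φ v ≠ 0) :
    (G.connectedComponentMk v).toSimpleGraph.IsBipartite := by
  have hsq (w : G.connectedComponentMk v) : φ w = φ v ∨ φ w = -φ v :=
    sq_eq_sq_iff_eq_or_eq_neg.1 (eq_of_reachable (f := fun w => φ w ^ 2)
      (fun u w huw => by rw [hφ u w huw, neg_one_mul, neg_sq]) (ConnectedComponent.exact w.2))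
  have hne : φ v ≠ -φ v := fun h =>
    mul_ne_zero two_ne_zero hv (by rw [two_mul, add_eq_zero_iff_eq_neg, ← h])
  classical
  refine ⟨Coloring.mk (fun w => if φ w = φ v then 0 else 1) fun {u w} huw => ?_⟩
  have hw : φ w = -φ u := (hφ u w huw).trans (neg_one_mul _)
  rcases hsq u with hu | hu
  · rw [if_pos hu, if_neg (by rw [hw, hu]; exact hne.symm)]
    exact zero_ne_one
  · rw [if_neg (by rw [hu]; exact hne.symm), if_pos (by rw [hw, hu, neg_neg])]
    exact one_ne_zero

theorem exists_mem_twistedFunctions_of_isBipartite {C : G.ConnectedComponent}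
    (hC : C.toSimpleGraph.IsBipartite) :
    ∃ φ ∈ twistedFunctions G (-1 : K), ∀ v ∈ C, φ v ≠ 0 := by
  classical
  obtain ⟨c⟩ := hC
  refine ⟨fun v => if h : v ∈ C then (-1) ^ (c ⟨v, h⟩ : ℕ) else 0, fun u v huv => ?_,
    fun v hv => ?_⟩
  all_goals beta_reduce
  · have huv' : u ∈ C ↔ v ∈ C := C.mem_supp_congr_adj huv
    by_cases hu : u ∈ C
    · have hc : c ⟨u, hu⟩ ≠ c ⟨v, huv'.1 hu⟩ := c.valid huv
      rw [dif_pos hu, dif_pos (huv'.1 hu), ← pow_succ']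
      refine neg_one_pow_congr ?_
      grind
    · rw [dif_neg hu, dif_neg (mt huv'.2 hu), mul_zero]
  · rw [dif_pos hv]
    exact pow_ne_zero _ (neg_ne_zero.2 one_ne_zero)

theorem finrank_twistedFunctions_neg_one [Finite V] [NeZero (2 : K)] :
    finrank K (twistedFunctions G (-1 : K)) = numBipComp G :=
  finrank_twistedFunctions (neg_ne_zero.2 one_ne_zero)
    (fun _ hφ _ hv => isBipartite_of_mem_twistedFunctions hφ hv)
    fun _ hC => exists_mem_twistedFunctions_of_isBipartite hC

theorem numBipComp_add_numNonBipComp [Finite V] :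
    numBipComp G + numNonBipComp G = numComp G := by
  classical
  rw [numBipComp, numNonBipComp, ← Nat.card_sum, numComp]
  exact Nat.card_congr (Equiv.sumCompl _)

theorem isBipartite_iff_numNonBipComp_eq_zero [Finite V] :
    G.IsBipartite ↔ numNonBipComp G = 0 := by
  rw [numNonBipComp, Finite.card_eq_zero_iff, isEmpty_subtype]
  simp only [not_not]
  exact colorable_iff_forall_connectedComponent

variable [Fintype V] [DecidableEq V] [DecidableRel G.Adj]

theorem eigenspace_transitionMatrix_eq_twistedFunctions (hG : ∀ v, 0 < G.degree v) {l : ℂ}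
    (hl : l ^ 2 = 1) :
    Module.End.eigenspace (toLin' (transitionMatrix ℂ G)) l = twistedFunctions G l := by
  obtain ⟨O⟩ := (inferInstance : Nonempty (Orientation G))
  ext φ
  rw [← O.ker_incidence_transpose hG hl, O.mem_ker_incidence_transpose hl]
  constructor
  · intro h u v huv
    have he : φ (O.tgt ⟨s(u, v), huv⟩) = l * φ (O.src ⟨s(u, v), huv⟩) := congrFun h _
    rcases O.tgt_src_eq_iff.2 (rfl : (⟨s(u, v), huv⟩ : G.edgeSet).1 = s(u, v)) with
      ⟨htgt, hsrc⟩ | ⟨hsrc, htgt⟩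
    · rw [htgt, hsrc] at he
      exact ((smul_eq_iff_eq_smul_of_sq_eq_one hl).2 he).symm
    · rwa [htgt, hsrc] at he
  · exact fun h => funext fun e => h _ _ (O.adj e)

theorem geomMult_transitionMatrix_one (hG : ∀ v, 0 < G.degree v) :
    geomMult (transitionMatrix ℂ G) 1 = numComp G := by
  rw [geomMult, eigenspace_transitionMatrix_eq_twistedFunctions hG (one_pow 2),
    finrank_twistedFunctions_one]

theorem geomMult_transitionMatrix_neg_one (hG : ∀ v, 0 < G.degree v) :
    geomMult (transitionMatrix ℂ G) (-1) = numBipComp G := by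
  rw [geomMult, eigenspace_transitionMatrix_eq_twistedFunctions hG (by norm_num),
    finrank_twistedFunctions_neg_one]

end TwistedFunctions

section Complexity

variable {V : Type*} {G : SimpleGraph V}

theorem connected_deleteEdges_iff_not_isBridge (hG : G.Connected) {e : Sym2 V} :
    (G.deleteEdges {e}).Connected ↔ ¬ G.IsBridge e := by
  induction e with | h u v
  exact ⟨fun h hb => hb (h.preconnected u v), hG.connected_delete_edge_of_not_isBridge⟩

theorem injOn_deleteEdges_singleton : InjOn (fun e => G.deleteEdges {e}) G.edgeSet := by
  intro e he f _ (h : G.deleteEdges {e} = G.deleteEdges {f})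
  by_contra hne
  have hmem : e ∈ (G.deleteEdges {f}).edgeSet := by
    rw [edgeSet_deleteEdges]
    exact ⟨he, hne⟩
  rw [← h, edgeSet_deleteEdges] at hmem
  exact hmem.2 rfl

theorem edgeFinset_deleteEdges_singleton [DecidableEq V] [Fintype G.edgeSet] (e : Sym2 V)
    [Fintype (G.deleteEdges {e}).edgeSet] :
    (G.deleteEdges {e}).edgeFinset = G.edgeFinset \ {e} := by
  ext f
  simp

variable [Fintype V] [DecidableRel G.Adj]

theorem setOf_spanningTree_eq_image (hG : G.Connected)
    (hcard : G.edgeFinset.card = Fintype.card V) :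
    {T : SimpleGraph V | T ≤ G ∧ T.IsTree} =
      (fun e => G.deleteEdges {e}) '' {e ∈ G.edgeSet | ¬ G.IsBridge e} := by
  classical
  ext T
  constructor
  · rintro ⟨hTG, hT⟩
    have hsub : T.edgeFinset ⊆ G.edgeFinset := edgeFinset_mono hTG
    have hdiff : (G.edgeFinset \ T.edgeFinset).card = 1 := by
      rw [Finset.card_sdiff_of_subset hsub, hcard, ← hT.card_edgeFinset, Nat.add_sub_cancel_left]
    obtain ⟨e, he⟩ := Finset.card_eq_one.1 hdiff
    have hTe : G.deleteEdges {e} = T := by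
      rw [← edgeFinset_inj, edgeFinset_deleteEdges_singleton, ← he,
        Finset.sdiff_sdiff_eq_self hsub]
    refine ⟨e, ⟨?_, ?_⟩, hTe⟩
    · exact mem_edgeFinset.1 (Finset.mem_sdiff.1 (he ▸ Finset.mem_singleton_self e)).1
    · rw [← connected_deleteEdges_iff_not_isBridge hG, hTe]
      exact hT.connected
  · rintro ⟨e, ⟨he, hb⟩, rfl⟩
    refine ⟨deleteEdges_le _, isTree_iff_connected_and_card.2
      ⟨(connected_deleteEdges_iff_not_isBridge hG).2 hb, ?_⟩⟩
    rw [Nat.card_eq_fintype_card, ← edgeFinset_card, edgeFinset_deleteEdges_singleton,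
      Finset.sdiff_singleton_eq_erase, Finset.card_erase_add_one (mem_edgeFinset.2 he), hcard,
      Nat.card_eq_fintype_card]

variable [DecidableEq V]

instance : DecidablePred G.IsBridge := fun e =>
  e.recOnSubsingleton fun u v =>
    inferInstanceAs (Decidable (¬ (G.deleteEdges {s(u, v)}).Reachable u v))

theorem complexity_eq_card_filter_not_isBridge (hG : G.Connected)
    (hcard : G.edgeFinset.card = Fintype.card V) :
    complexity G = (G.edgeFinset.filter fun e => ¬ G.IsBridge e).card := by
  rw [complexity, ← ncard_coe_finset, Finset.coe_filter]
  simp only [mem_edgeFinset]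
  rw [← (injOn_deleteEdges_singleton.mono fun _ he => he.1).ncard_image,
    ← setOf_spanningTree_eq_image hG hcard]
  rfl

theorem connected_squareWithTwoPaths : squareWithTwoPaths.Connected :=
  (connected_iff_exists_forall_reachable _).2 ⟨0, by decide +kernel⟩

theorem complexity_cycleGraph_eight : complexity (cycleGraph 8) = 8 := by
  rw [complexity_eq_card_filter_not_isBridge cycleGraph_connected (by decide +kernel)]
  decide +kernel

theorem complexity_squareWithTwoPaths : complexity squareWithTwoPaths = 4 := by
  rw [complexity_eq_card_filter_not_isBridge connected_squareWithTwoPaths (by decide +kernel)]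
  decide +kernel

end Complexity

section Transplantation

theorem mapMatrix_transitionMatrix {V K L : Type*} [Fintype V] [DecidableEq V] [Field K] [Field L]
    (G : SimpleGraph V) [DecidableRel G.Adj] (f : K →+* L) :
    f.mapMatrix (transitionMatrix K G) = transitionMatrix L G := by
  ext v w
  rw [RingHom.mapMatrix_apply, map_apply]
  simp only [transitionMatrix, diagonal_mul, adjMatrix_apply, map_mul, map_inv₀,
    map_natCast, apply_ite f, map_one, map_zero]

/-- A transplantation of functions from the circuit of length `8` to `squareWithTwoPaths`. The
reflection `i ↦ -i` splits a function on the circuit into an even part `e` and an odd part `o`. Up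
to a factor `2`, the even part is copied to the path `2 - {1, 3} - 0 - {4, 6} - {5, 7}` obtained by
folding `squareWithTwoPaths`, and the odd part yields the function with the values
`o 1 - o 3`, `o 2`, `o 1 + o 3` at `1, 4, 5` which changes sign under the folding. -/
def transplantation : Matrix (Fin 8) (Fin 8) ℚ :=
  !![0, 0, 1, 0, 0, 0, 1, 0;
    0, 2, 0, -1, 0, 1, 0, 0;
    2, 0, 0, 0, 0, 0, 0, 0;
    0, 0, 0, 1, 0, -1, 0, 2;
    0, 0, 1, 1, 0, 1, -1, 0;
    0, 1, 0, 1, 2, -1, 0, -1;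
    0, 0, -1, 1, 0, 1, 1, 0;
    0, -1, 0, -1, 2, 1, 0, 1]

theorem isUnit_transplantation : IsUnit transplantation := by
  let Q : Matrix (Fin 8) (Fin 8) ℚ :=
    !![0, 0, 4, 0, 0, 0, 0, 0;
      0, 3, 0, 1, 0, 1, 0, -1;
      4, 0, 0, 0, 2, 0, -2, 0;
      0, -1, 0, 1, 2, 1, 2, -1;
      0, 0, 0, 0, 0, 2, 0, 2;
      0, 1, 0, -1, 2, -1, 2, 1;
      4, 0, 0, 0, -2, 0, 2, 0;
      0, 1, 0, 3, 0, -1, 0, 1]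
  have hPQ : transplantation * ((8 : ℚ)⁻¹ • Q) = 1 := by decide +kernel
  exact IsUnit.of_mul_eq_one _ hPQ

theorem transplantation_mul_transitionMatrix :
    transplantation * transitionMatrix ℚ (cycleGraph 8) =
      transitionMatrix ℚ squareWithTwoPaths * transplantation := by
  decide +kernel

theorem geomMult_transitionMatrix_cycleGraph_eight :
    geomMult (transitionMatrix ℂ (cycleGraph 8)) =
      geomMult (transitionMatrix ℂ squareWithTwoPaths) := by
  let f : ℚ →+* ℂ := algebraMap ℚ ℂ
  refine geomMult_eq_of_mul_eq_mul (isUnit_transplantation.map f.mapMatrix) ?_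
  have h := congrArg f.mapMatrix transplantation_mul_transitionMatrix
  rwa [map_mul, map_mul, mapMatrix_transitionMatrix, mapMatrix_transitionMatrix] at h

end Transplantation

end

end QGraph

theorem theorem5p5 :
    -- what the spectrum of either Laplacian determines
    (∀ {V₁ V₂ : Type*} [Fintype V₁] [DecidableEq V₁] [Fintype V₂] [DecidableEq V₂]
      (G₁ : SimpleGraph V₁) (G₂ : SimpleGraph V₂) [DecidableRel G₁.Adj] [DecidableRel G₂.Adj]
      (O₁ : QGraph.Orientation G₁) (O₂ : QGraph.Orientation G₂),
      (∀ v, 0 < G₁.degree v) → (∀ v, 0 < G₂.degree v) →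
      (QGraph.Isospectral (QGraph.laplacianCK O₁) (QGraph.laplacianCK O₂) ∨
        QGraph.Isospectral (QGraph.laplacianKC O₁) (QGraph.laplacianKC O₂)) →
      Fintype.card V₁ = Fintype.card V₂ ∧
      G₁.edgeFinset.card = G₂.edgeFinset.card ∧
      QGraph.numComp G₁ = QGraph.numComp G₂ ∧
      QGraph.numBipComp G₁ = QGraph.numBipComp G₂ ∧
      QGraph.numNonBipComp G₁ = QGraph.numNonBipComp G₂ ∧
      (G₁.IsBipartite ↔ G₂.IsBipartite)) ∧
    -- what it does not determine
    ((∀ v, 0 < (SimpleGraph.cycleGraph 8).degree v) ∧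
      (∀ v, 0 < QGraph.squareWithTwoPaths.degree v) ∧
      (∀ (O₁ : QGraph.Orientation (SimpleGraph.cycleGraph 8))
        (O₂ : QGraph.Orientation QGraph.squareWithTwoPaths),
        QGraph.Isospectral (QGraph.laplacianCK O₁) (QGraph.laplacianCK O₂) ∧
        QGraph.Isospectral (QGraph.laplacianKC O₁) (QGraph.laplacianKC O₂)) ∧
      QGraph.degrees (SimpleGraph.cycleGraph 8) ≠ QGraph.degrees QGraph.squareWithTwoPaths ∧
      (∃ d, (SimpleGraph.cycleGraph 8).IsRegularOfDegree d) ∧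
      (¬ ∃ d, QGraph.squareWithTwoPaths.IsRegularOfDegree d) ∧
      QGraph.complexity (SimpleGraph.cycleGraph 8) = 8 ∧
      QGraph.complexity QGraph.squareWithTwoPaths = 4) := by
  refine ⟨fun G₁ G₂ _ _ O₁ O₂ hG₁ hG₂ h => ?_, by decide +kernel, by decide +kernel,
    fun O₁ O₂ => ?_, by decide +kernel, ⟨2, fun v => ?_⟩, ?_,
    QGraph.complexity_cycleGraph_eight, QGraph.complexity_squareWithTwoPaths⟩
  · obtain ⟨hE, hmult⟩ := h.elim (QGraph.isospectral_laplacianCK_iff hG₁ hG₂ O₁ O₂).1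
      (QGraph.isospectral_laplacianKC_iff hG₁ hG₂ O₁ O₂).1
    have hcomp : QGraph.numComp G₁ = QGraph.numComp G₂ := by
      rw [← QGraph.geomMult_transitionMatrix_one hG₁, hmult,
        QGraph.geomMult_transitionMatrix_one hG₂]
    have hbip : QGraph.numBipComp G₁ = QGraph.numBipComp G₂ := by
      rw [← QGraph.geomMult_transitionMatrix_neg_one hG₁, hmult,
        QGraph.geomMult_transitionMatrix_neg_one hG₂]
    have hnonbip : QGraph.numNonBipComp G₁ = QGraph.numNonBipComp G₂ := by
      rwa [← QGraph.numBipComp_add_numNonBipComp, ← QGraph.numBipComp_add_numNonBipComp, hbip,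
        Nat.add_left_cancel_iff] at hcomp
    refine ⟨QGraph.card_eq_of_geomMult_eq hG₁ hG₂ hmult, hE, hcomp, hbip, hnonbip, ?_⟩
    rw [QGraph.isBipartite_iff_numNonBipComp_eq_zero, hnonbip,
      QGraph.isBipartite_iff_numNonBipComp_eq_zero]
  · have hmult := congrFun QGraph.geomMult_transitionMatrix_cycleGraph_eight
    rw [QGraph.isospectral_laplacianCK_iff (by decide +kernel) (by decide +kernel),
      QGraph.isospectral_laplacianKC_iff (by decide +kernel) (by decide +kernel)]
    exact ⟨⟨by decide +kernel, hmult⟩, by decide +kernel, hmult⟩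
  · exact SimpleGraph.cycleGraph_degree_three_le
  · exact fun ⟨d, hd⟩ => absurd ((hd 5).trans (hd 1).symm) (by decide +kernel)
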